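/- \textbf{Conventions.} A \emph{modulus of continuity} is a continuous function $\varpi\colon[0,\infty)\to[0,\infty)$ with $\varpi(0)=0$. Let $\mathcal L$ be a countable language for continuous logic: countably many function symbols $f$ and relation symbols $R$, each with a finite arity $n_f$, $n_R$ and a modulus of continuity $\varpi_f$, $\varpi_R$. Let $\mathbb U$ be the Urysohn sphere: the separable, complete, ultrahomogeneous metric space with metric bounded by $1$ that contains an isometric copy of every separable metric space with metric bounded by $1$. Finite powers carry the maximum metric, also denoted $d$. Let $\mathrm{Iso}(\mathbb U)$ be its isometry group with the topology of pointwise convergence, and let $\mathbf p=(p_n)_{n\in\mathbb N}$ be a fixed enumeration of a dense subset of $\mathbb U$; write $\mathbf p_{|k}=(p_0,\dots,p_{k-1})$. $\mathrm{Mod}(\mathcal L,\mathbb U)$ is the space of $\mathcal L$-structures $M$ with support $\mathbb U$: each $f$ is interpreted by a map $f^M\colon\mathbb U^{n_f}\to\mathbb U$ and each $R$ by a map $R^M\colon\mathbb U^{n_R}\to[0,1]$, uniformly continuous with moduli $\varpi_f$, $\varpi_R$; the topology is that of pointwise convergence of all interpretations. $\mathrm{Iso}(\mathbb U)$ acts by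 $f^{gM}(\bar a)=g f^M(g^{-1}\bar a)$, $R^{gM}(\bar a)=R^M(g^{-1}\bar a)$. A \emph{Borel grey subset} of $\mathrm{Mod}(\mathcal L,\mathbb U)$ is a Borel function $A\colon\mathrm{Mod}(\mathcal L,\mathbb U)\to[0,1]$. $\mathcal L_{\omega_1\omega}$-formulas with free variables among $x_0,\dots,x_{n-1}$ are built from the atomic formulas $d(s,t)$ and $R(\bar t)$ ($s,t,\bar t$ terms) by continuous connectives $h\colon[0,1]^m\to[0,1]$, by the quantifiers $\inf_x$, $\sup_x$, and by countable $\inf_n\varphi_n$, $\sup_n\varphi_n$, the last two only when some single modulus of continuity bounds the moduli of all $\varphi_n$. The value $\varphi^M(u)\in[0,1]$ is defined as usual. The modulus of a formula is defined by recursion, as a function of the amounts $t_i\ge0$ by which the free variables $x_i$ are moved. A variable $x_i$ has modulus $t_i$. For a symbol applied to terms, apply $s\mapsto\sup_{s'\le s}\varpi(s')$, with $\varpi$ the modulus of the symbol, to the maximum of the moduli of the terms. For $d(s,t)$, add the moduli of $s$ and $t$. For $h(\varphi_0,\dots,\varphi_{m-1})$, take $\sup|h(a)-h(b)|$ over all $a,b\in[0,1]^m$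 with each $|a_i-b_i|$ at most the modulus of $\varphi_i$. For $\inf_x\varphi$ and $\sup_x\varphi$, take the modulus of $\varphi$ with the bound variable not moved. For $\inf_n\varphi_n$ and $\sup_n\varphi_n$, take the supremum of the moduli. A formula is \emph{$N$-Lipschitz} if its modulus, with all free variables moved by $t$, is at most $Nt$ for every $t\ge0$. For a function $B\colon\mathrm{Iso}(\mathbb U)\to[0,1]$, $\sup^*_{g}B(g)$ is the unique element of $[0,1]$ such that for all $r\in[0,1]$: $\sup^*_{g}B(g)>r$ if and only if $\{g: B(g)>r\}$ is nonmeagre. Differences are truncated to $[0,1]$. \textbf{Theorem.} Let $\mathcal L$, $\mathbb U$, $\mathbf p$ be as above and let $k\in\mathbb N$. For every Borel grey subset $A$ of $\mathrm{Mod}(\mathcal L,\mathbb U)$ and every $N\in\mathbb N$ there is an $N$-Lipschitz $\mathcal L_{\omega_1\omega}$-formula $\varphi$ with $k$ free variables (that is, with free variables among $x_0,\dots,x_{k-1}$) such that for every $M\in\mathrm{Mod}(\mathcal L,\mathbb U)$ and every $u\in\mathbb U^k$, $$\sup\nolimits^*_{g\in\mathrm{Iso}(\mathbb U)}\bigl[A(gM)-N\,d(g^{-1}\mathbf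 p_{|k},u)\bigr]=\varphi^M(u).$$ -/

import Mathlib

open scoped NNReal ENNReal

universe u v w

/-! ### Languages and structures of continuous logic -/

/-- A modulus of continuity: a continuous function on the nonnegative reals that vanishes
at zero. -/
structure ContModulus where
  toFun : ℝ≥0 → ℝ≥0
  continuous_toFun : Continuous toFun
  map_zero : toFun 0 = 0

/-- The least monotone function above a modulus, with arguments and values in `[0, ∞]`.
It agrees with the modulus itself whenever the latter is nondecreasing. -/
noncomputable def ContModulus.hull (w : ContModulus) (t : ℝ≥0∞) : ℝ≥0∞ :=
  ⨆ (s : ℝ≥0) (_ : (s : ℝ≥0∞) ≤ t), (w.toFun s : ℝ≥0∞)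

set_option linter.checkUnivs false in
/-- A language for continuous logic: function and relation symbols, each with a finite arity
and a modulus of continuity. -/
structure MetricLanguage where
  Func : Type u
  Rel : Type v
  funcArity : Func → ℕ
  relArity : Rel → ℕ
  funcModulus : Func → ContModulus
  relModulus : Rel → ContModulus

/-- The language has countably many symbols. -/
def MetricLanguage.IsCountable (L : MetricLanguage.{u, v}) : Prop :=
  Countable L.Func ∧ Countable L.Rel

/-- The set `Mod(L, Y)` of `L`-structures with support the metric space `Y`. Finite powers
of `Y` (here `Fin n → Y`) carry the maximum metric. -/
@[ext]
structure MetricModel (L : MetricLanguage.{u, v}) (Y : Type w) [MetricSpace Y] where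
  func : ∀ f : L.Func, (Fin (L.funcArity f) → Y) → Y
  rel : ∀ R : L.Rel, (Fin (L.relArity R) → Y) → unitInterval
  func_modulus : ∀ f a b, nndist (func f a) (func f b) ≤ (L.funcModulus f).toFun (nndist a b)
  rel_modulus : ∀ R a b, nndist (rel R a) (rel R b) ≤ (L.relModulus R).toFun (nndist a b)

/-- The topology of pointwise convergence of the interpretations of all symbols. -/
instance MetricModel.instTopologicalSpace (L : MetricLanguage.{u, v}) (Y : Type w) [MetricSpace Y] :
    TopologicalSpace (MetricModel L Y) :=
  TopologicalSpace.induced (fun M => (M.func, M.rel)) inferInstance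

/-- The Borel σ-algebra on the space of structures. -/
instance MetricModel.instMeasurableSpace (L : MetricLanguage.{u, v}) (Y : Type w) [MetricSpace Y] :
    MeasurableSpace (MetricModel L Y) := borel _

instance MetricModel.instBorelSpace (L : MetricLanguage.{u, v}) (Y : Type w) [MetricSpace Y] :
    BorelSpace (MetricModel L Y) := ⟨rfl⟩

/-- The topology of pointwise convergence on the isometry group. -/
instance isometryGroupTopology (Y : Type w) [MetricSpace Y] : TopologicalSpace (Y ≃ᵢ Y) :=
  TopologicalSpace.induced (fun g => (g : Y → Y)) inferInstance

/-- The action of the isometry group of `Y` on the structures supported on `Y`, for which `g`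
is an isomorphism from `M` onto `g • M`. -/
instance MetricModel.instMulAction (L : MetricLanguage.{u, v}) (Y : Type w) [MetricSpace Y] :
    MulAction (Y ≃ᵢ Y) (MetricModel L Y) where
  smul g M :=
    { func := fun f a => g (M.func f (fun i => g⁻¹ (a i)))
      rel := fun R a => M.rel R (fun i => g⁻¹ (a i))
      func_modulus := by
        intro f a b
        have h : nndist (fun i => g⁻¹ (a i)) (fun i => g⁻¹ (b i)) = nndist a b := by
          simp [nndist_pi_def, g⁻¹.isometry.nndist_eq]
        rw [g.isometry.nndist_eq, ← h]
        exact M.func_modulus f _ _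
      rel_modulus := by
        intro R a b
        have h : nndist (fun i => g⁻¹ (a i)) (fun i => g⁻¹ (b i)) = nndist a b := by
          simp [nndist_pi_def, g⁻¹.isometry.nndist_eq]
        rw [← h]
        exact M.rel_modulus R _ _ }
  one_smul _ := rfl
  mul_smul _ _ _ := rfl

/-! ### Infinitary formulas -/

/-- Terms in the variables `x_0, …, x_{n-1}`. -/
inductive MetricTerm (L : MetricLanguage.{u, v}) (n : ℕ) : Type _
  | var : Fin n → MetricTerm L n
  | app : (f : L.Func) → (Fin (L.funcArity f) → MetricTerm L n) → MetricTerm L n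

namespace MetricTerm

variable {L : MetricLanguage.{u, v}} {n : ℕ}

/-- The interpretation of a term. -/
def eval {Y : Type w} [MetricSpace Y] (M : MetricModel L Y) (u : Fin n → Y) :
    MetricTerm L n → Y
  | var i => u i
  | app f ts => M.func f (fun i => (ts i).eval M u)

/-- The modulus of continuity of a term, as a function of the amounts `t i` by which the
variables `x_i` are moved. -/
noncomputable def modulus (t : Fin n → ℝ≥0∞) : MetricTerm L n → ℝ≥0∞
  | var i => t i
  | app f ts => (L.funcModulus f).hull (⨆ i, (ts i).modulus t)

end MetricTerm

/-- Infinitary expressions whose free variables are among `x_0, …, x_{n-1}`; the quantifiers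
`infVar` and `supVar` bind the last variable. The restriction on countable infima and suprema
is imposed separately, by `PreFormula.WellFormed`. -/
inductive PreFormula (L : MetricLanguage.{u, v}) : ℕ → Type _
  | dist {n : ℕ} : MetricTerm L n → MetricTerm L n → PreFormula L n
  | rel {n : ℕ} : (R : L.Rel) → (Fin (L.relArity R) → MetricTerm L n) → PreFormula L n
  | conn {n m : ℕ} : C(Fin m → unitInterval, unitInterval) → (Fin m → PreFormula L n) →
      PreFormula L n
  | infVar {n : ℕ} : PreFormula L (n + 1) → PreFormula L n
  | supVar {n : ℕ} : PreFormula L (n + 1) → PreFormula L n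
  | infSeq {n : ℕ} : (ℕ → PreFormula L n) → PreFormula L n
  | supSeq {n : ℕ} : (ℕ → PreFormula L n) → PreFormula L n

/-- Truncation of a real number to `[0, 1]`. -/
noncomputable def truncUnit (x : ℝ) : unitInterval := Set.projIcc 0 1 zero_le_one x

namespace PreFormula

variable {L : MetricLanguage.{u, v}}

/-- The interpretation of a formula. On a space with metric bounded by `1` the truncation in
the first clause has no effect. -/
noncomputable def eval {Y : Type w} [MetricSpace Y] (M : MetricModel L Y) :
    {n : ℕ} → PreFormula L n → (Fin n → Y) → unitInterval
  | _, dist s t, u => truncUnit (Dist.dist (s.eval M u) (t.eval M u))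
  | _, rel R ts, u => M.rel R (fun i => (ts i).eval M u)
  | _, conn h φ, u => h (fun i => (φ i).eval M u)
  | _, infVar φ, u => ⨅ y : Y, φ.eval M (Fin.snoc u y)
  | _, supVar φ, u => ⨆ y : Y, φ.eval M (Fin.snoc u y)
  | _, infSeq φ, u => ⨅ i, (φ i).eval M u
  | _, supSeq φ, u => ⨆ i, (φ i).eval M u

/-- The modulus of continuity of a formula, by recursion on its complexity, as a function of
the amounts `t i` by which the free variables `x_i` are moved. A connective `h` contributes its
optimal modulus `s ↦ sup {|h x - h y| : |x_i - y_i| ≤ s_i for all i}`; a variable that is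
quantified over is not moved. -/
noncomputable def modulus : {n : ℕ} → PreFormula L n → (Fin n → ℝ≥0∞) → ℝ≥0∞
  | _, dist r s, t => r.modulus t + s.modulus t
  | _, rel R ts, t => (L.relModulus R).hull (⨆ i, (ts i).modulus t)
  | _, conn (m := m) h φ, t =>
      ⨆ (x : Fin m → unitInterval) (y : Fin m → unitInterval)
        (_ : ∀ i, edist (x i) (y i) ≤ (φ i).modulus t), edist (h x) (h y)
  | _, infVar φ, t => φ.modulus (Fin.snoc t 0)
  | _, supVar φ, t => φ.modulus (Fin.snoc t 0)
  | _, infSeq φ, t => ⨆ i, (φ i).modulus t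
  | _, supSeq φ, t => ⨆ i, (φ i).modulus t

/-- A sequence of formulas has uniformly bounded moduli: a single modulus of continuity, with
respect to the maximum metric on tuples, bounds the moduli of all of them. -/
def UniformlyBounded {n : ℕ} (φ : ℕ → PreFormula L n) : Prop :=
  ∃ w : ContModulus, ∀ (i : ℕ) (t : ℝ≥0), (φ i).modulus (fun _ => (t : ℝ≥0∞)) ≤ w.toFun t

/-- Countable infima and suprema are only taken of sequences with uniformly bounded moduli. -/
def WellFormed : {n : ℕ} → PreFormula L n → Prop
  | _, dist _ _ => True
  | _, rel _ _ => True
  | _, conn _ φ => ∀ i, (φ i).WellFormed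
  | _, infVar φ => φ.WellFormed
  | _, supVar φ => φ.WellFormed
  | _, infSeq φ => (∀ i, (φ i).WellFormed) ∧ UniformlyBounded φ
  | _, supSeq φ => (∀ i, (φ i).WellFormed) ∧ UniformlyBounded φ

end PreFormula

/-- The formulas of the infinitary continuous logic `L_{ω₁ω}` with free variables among
`x_0, …, x_{n-1}`. -/
def InfFormula (L : MetricLanguage.{u, v}) (n : ℕ) : Type _ := {φ : PreFormula L n // φ.WellFormed}

namespace InfFormula

variable {L : MetricLanguage.{u, v}} {n : ℕ}

/-- The value `φ^M(u)`. -/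
noncomputable def eval (φ : InfFormula L n) {Y : Type w} [MetricSpace Y] (M : MetricModel L Y)
    (u : Fin n → Y) : unitInterval := φ.1.eval M u

/-- A formula is `N`-Lipschitz if its modulus of continuity, with respect to the maximum metric
on tuples, is bounded above by `t ↦ N t`. -/
def IsLipschitz (N : ℕ) (φ : InfFormula L n) : Prop :=
  ∀ t : ℝ≥0, φ.1.modulus (fun _ => (t : ℝ≥0∞)) ≤ (N : ℝ≥0∞) * t

end InfFormula

/-! ### The Urysohn sphere and the category quantifier -/

/-- `U` is the Urysohn sphere: separable, complete, with metric bounded by `1`, ultrahomogeneous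
(isometries between finite subsets extend to isometries of `U`), and containing an isometric copy
of every separable metric space with metric bounded by `1`. Every separable metric space embeds
isometrically into `ℓ^∞(ℕ)`, so it is enough to quantify over the spaces in `Type`. -/
structure IsUrysohnSphere (U : Type w) [MetricSpace U] : Prop where
  separable : TopologicalSpace.SeparableSpace U
  complete : CompleteSpace U
  dist_le_one : ∀ x y : U, dist x y ≤ 1
  ultrahomogeneous : ∀ (n : ℕ) (a b : Fin n → U),
    (∀ i j, dist (a i) (a j) = dist (b i) (b j)) → ∃ g : U ≃ᵢ U, ∀ i, g (a i) = b i
  universal : ∀ (X : Type) [MetricSpace X] [TopologicalSpace.SeparableSpace X],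
    (∀ x y : X, dist x y ≤ 1) → ∃ f : X → U, Isometry f

/-- The category quantifier `sup*_{y ∈ Y} B(y)` of a grey subset `B` of `Y`; it is characterized
by `lt_supStar_iff`. -/
noncomputable def supStar {Y : Type w} [TopologicalSpace Y] (B : Y → unitInterval) :
    unitInterval :=
  sSup {r | ¬ IsMeagre {y | r < B y}}

/-- `sup*_y B(y) > r` if and only if `B(y) > r` for nonmeagerly many `y`. -/
theorem lt_supStar_iff {Y : Type w} [TopologicalSpace Y] (B : Y → unitInterval)
    (r : unitInterval) : r < supStar B ↔ ¬ IsMeagre {y | r < B y} := by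
  constructor
  · intro h hm
    obtain ⟨s, hs, hrs⟩ := lt_sSup_iff.mp h
    exact hs (hm.mono fun y hy => hrs.trans hy)
  · intro h
    by_contra hr
    apply h
    obtain ⟨D, hDc, hD⟩ := TopologicalSpace.exists_countable_dense unitInterval
    have : Countable D := hDc.to_subtype
    have key : IsMeagre (⋃ d : {d : D // r < d.1}, {y | (d.1 : unitInterval) < B y}) := by
      refine isMeagre_iUnion fun d => ?_
      by_contra hd
      exact hr (d.2.trans_le (le_sSup hd))
    refine key.mono fun y hy => ?_
    obtain ⟨d, hdD, hd⟩ := hD.exists_between hy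
    exact Set.mem_iUnion.mpr ⟨⟨⟨d, hdD⟩, hd.1⟩, hd.2⟩

/-!
The formula is found by induction on Borel sets `B`, through the grey Vaught transforms `sup*_g
[r 1_B(g M) - N d(g⁻¹ p|k, u)]` (`vaught`). A value `s` is below such a transform if and only if
`g M ∈ B` for nonmeagrely many `g` in the open set `{g | s < r - N d(g⁻¹ p|k, u)}`.

*Control of moduli.* If a formula `φ` takes `N`-Lipschitz values, then `sup_y (φ(y) - N d(x, y))`
has the same values. All variables of `φ` are bound in it, so that its modulus is at most `t ↦ N
t` whatever the modulus of `φ` (`IsDefinable.exists_isLipschitz`). Hence only definability and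
the values of formulas need attention, and countable suprema and infima may be taken freely of
grey relations with `N`-Lipschitz values (`IsDefinable.iSup`, `IsDefinable.iInf`).

*Quantification over orbits.* In the Urysohn sphere a tuple whose distance matrix is close to
that of `p|l` is close to the orbit of `p|l` (`IsUrysohnSphere.exists_preimageTuple_dist_le`).
Hence a supremum over the tuples `g⁻¹ p|l` is a limit of suprema over all tuples with a growing
penalty for the difference of the distance matrices. It follows that `sup {r - N d(g⁻¹ p|k, u) :
Θ(g⁻¹ p|l) > 0}` is definable for definable equicontinuous `Θ`
(`IsUrysohnSphere.isDefinable_orbitSup`).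

*The induction.* The isometry group is Polish, hence a Baire space (`baireSpace_isometryEquiv`).
For a basic open condition on atomic relations, the set of `g` in question is open, so that
nonmeagre means nonempty, and the transform is a supremum over an orbit
(`isDefinable_vaught_lt`). For a complement, the Baire property shows that the set is nonmeagre
if and only if it is comeagre near some tuple `g₀⁻¹ p|l`, that is, if and only if the transform
of `B` is less than `1` at this tuple; so the transform of the complement is again a supremum
over orbits (`isDefinable_vaught_compl`). Countable unions become countable suprema. The basic
sets generate the Borel σ-algebra because structures converge if and only if their atomic
relations converge at the points of `p` (`isInducing_atomicValues`). Finally, a Borel grey set is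
a countable supremum of multiples of indicator functions of Borel sets
(`supStar_eq_iSup_vaught`).
-/

/-! ### Renaming and quantification of variables -/

lemma ContModulus.hull_zero (w : ContModulus) : w.hull 0 = 0 := by
  simp [ContModulus.hull, w.map_zero]

/-- The extension of a renaming of variables to one more variable, placed last and kept last. -/
def liftRename {n m : ℕ} (f : Fin n → Fin m) : Fin (n + 1) → Fin (m + 1) :=
  Fin.snoc (α := fun _ => Fin (m + 1)) (fun i => (f i).castSucc) (Fin.last m)

lemma snoc_comp_liftRename {α : Type*} {n m : ℕ} (f : Fin n → Fin m) (u : Fin m → α) (y : α) :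
    (fun i => Fin.snoc (α := fun _ => α) u y (liftRename f i)) =
      Fin.snoc (α := fun _ => α) (fun i => u (f i)) y := by
  funext i
  refine Fin.lastCases ?_ (fun i => ?_) i <;> simp [liftRename]

namespace MetricTerm

variable {L : MetricLanguage.{u, v}} {n m : ℕ}

/-- Substitution of variables for variables in a term. -/
def rename (f : Fin n → Fin m) : MetricTerm L n → MetricTerm L m
  | var i => var (f i)
  | app s ts => app s (fun i => (ts i).rename f)

lemma eval_rename {Y : Type w} [MetricSpace Y] (M : MetricModel L Y) (f : Fin n → Fin m)
    (u : Fin m → Y) (t : MetricTerm L n) :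
    (t.rename f).eval M u = t.eval M (fun i => u (f i)) := by
  induction t with
  | var i => rfl
  | app s ts ih => simp [rename, eval, ih]

lemma modulus_rename (f : Fin n → Fin m) (t : Fin m → ℝ≥0∞) (s : MetricTerm L n) :
    (s.rename f).modulus t = s.modulus (fun i => t (f i)) := by
  induction s with
  | var i => rfl
  | app s ts ih => simp [rename, modulus, ih]

lemma modulus_zero (s : MetricTerm L n) : s.modulus (fun _ => 0) = 0 := by
  induction s with
  | var i => rfl
  | app s ts ih => simp [modulus, ih, ContModulus.hull_zero]

end MetricTerm

namespace PreFormula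

variable {L : MetricLanguage.{u, v}}

/-- Substitution of free variables for the free variables of a formula. -/
def rename : {n m : ℕ} → (Fin n → Fin m) → PreFormula L n → PreFormula L m
  | _, _, f, dist s t => dist (s.rename f) (t.rename f)
  | _, _, f, rel R ts => rel R (fun i => (ts i).rename f)
  | _, _, f, conn h φ => conn h (fun i => (φ i).rename f)
  | _, _, f, infVar φ => infVar (φ.rename (liftRename f))
  | _, _, f, supVar φ => supVar (φ.rename (liftRename f))
  | _, _, f, infSeq φ => infSeq (fun i => (φ i).rename f)
  | _, _, f, supSeq φ => supSeq (fun i => (φ i).rename f)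

lemma eval_rename {Y : Type w} [MetricSpace Y] (M : MetricModel L Y) {n : ℕ}
    (φ : PreFormula L n) : ∀ {m : ℕ} (f : Fin n → Fin m) (u : Fin m → Y),
    (φ.rename f).eval M u = φ.eval M (fun i => u (f i)) := by
  induction φ with
  | dist s t => intro m f u; simp [rename, eval, MetricTerm.eval_rename]
  | rel R ts => intro m f u; simp [rename, eval, MetricTerm.eval_rename]
  | conn h φ ih => intro m f u; simp [rename, eval, ih]
  | infVar φ ih => intro m f u; simp [rename, eval, ih, snoc_comp_liftRename]
  | supVar φ ih => intro m f u; simp [rename, eval, ih, snoc_comp_liftRename]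
  | infSeq φ ih => intro m f u; simp [rename, eval, ih]
  | supSeq φ ih => intro m f u; simp [rename, eval, ih]

lemma modulus_rename {n : ℕ} (φ : PreFormula L n) : ∀ {m : ℕ} (f : Fin n → Fin m)
    (t : Fin m → ℝ≥0∞), (φ.rename f).modulus t = φ.modulus (fun i => t (f i)) := by
  induction φ with
  | dist s t => intro m f u; simp [rename, modulus, MetricTerm.modulus_rename]
  | rel R ts => intro m f u; simp [rename, modulus, MetricTerm.modulus_rename]
  | conn h φ ih => intro m f u; simp [rename, modulus, ih]
  | infVar φ ih => intro m f u; simp [rename, modulus, ih, snoc_comp_liftRename]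
  | supVar φ ih => intro m f u; simp [rename, modulus, ih, snoc_comp_liftRename]
  | infSeq φ ih => intro m f u; simp [rename, modulus, ih]
  | supSeq φ ih => intro m f u; simp [rename, modulus, ih]

lemma UniformlyBounded.rename {n m : ℕ} {φ : ℕ → PreFormula L n} (h : UniformlyBounded φ)
    (f : Fin n → Fin m) : UniformlyBounded (fun i => (φ i).rename f) := by
  obtain ⟨w, hw⟩ := h
  exact ⟨w, fun i t => by simpa [modulus_rename] using hw i t⟩

lemma WellFormed.rename {n : ℕ} {φ : PreFormula L n} (h : φ.WellFormed) :
    ∀ {m : ℕ} (f : Fin n → Fin m), (φ.rename f).WellFormed := by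
  induction φ with
  | dist s t => intro m f; trivial
  | rel R ts => intro m f; trivial
  | conn g φ ih => intro m f i; exact ih i (h i) f
  | infVar φ ih => intro m f; exact ih (show φ.WellFormed from h) (liftRename f)
  | supVar φ ih => intro m f; exact ih (show φ.WellFormed from h) (liftRename f)
  | infSeq φ ih => intro m f; exact ⟨fun i => ih i (h.1 i) f, h.2.rename f⟩
  | supSeq φ ih => intro m f; exact ⟨fun i => ih i (h.1 i) f, h.2.rename f⟩

/-- A formula all of whose free variables are bound by quantifiers outside it therefore contributes
nothing to the modulus of the result. -/
lemma modulus_zero {n : ℕ} (φ : PreFormula L n) : φ.modulus (fun _ => 0) = 0 := by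
  have hsnoc : ∀ n : ℕ, Fin.snoc (α := fun _ => ℝ≥0∞) (fun _ : Fin n => 0) 0 = fun _ => 0 := by
    intro n
    funext i
    refine Fin.lastCases ?_ (fun i => ?_) i <;> simp
  induction φ with
  | dist s t => simp [modulus, MetricTerm.modulus_zero]
  | rel R ts => simp [modulus, MetricTerm.modulus_zero, ContModulus.hull_zero]
  | conn h φ ih =>
    simp only [modulus, ih]
    refine le_antisymm (iSup_le fun x => iSup_le fun y => iSup_le fun hxy => ?_) bot_le
    have : x = y := funext fun i => edist_le_zero.mp (hxy i)
    simp [this]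
  | infVar φ ih => simp [modulus, hsnoc, ih]
  | supVar φ ih => simp [modulus, hsnoc, ih]
  | infSeq φ ih => simp [modulus, ih]
  | supSeq φ ih => simp [modulus, ih]

/-- Quantification by `sup` over the last `l` variables. -/
def supVars {k : ℕ} : (l : ℕ) → PreFormula L (k + l) → PreFormula L k
  | 0, φ => φ
  | l + 1, φ => supVars l (supVar φ)

lemma WellFormed.supVars {k : ℕ} : ∀ {l : ℕ} {φ : PreFormula L (k + l)}, φ.WellFormed →
    (φ.supVars l).WellFormed
  | 0, _, h => h
  | l + 1, φ, h => WellFormed.supVars (l := l) (φ := supVar φ) h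

lemma eval_supVars {Y : Type w} [MetricSpace Y] (M : MetricModel L Y) {k : ℕ} :
    ∀ {l : ℕ} (φ : PreFormula L (k + l)) (u : Fin k → Y),
      (φ.supVars l).eval M u = ⨆ y : Fin l → Y, φ.eval M (Fin.append u y)
  | 0, φ, u => by
    have h : ∀ y : Fin 0 → Y, Fin.append u y = u := fun y => by
      rw [Subsingleton.elim y Fin.elim0, Fin.append_elim0]; rfl
    simp [supVars, h]
  | l + 1, φ, u => by
    rw [supVars, eval_supVars]
    refine le_antisymm (iSup_le fun y => iSup_le fun z => ?_) (iSup_le fun y => ?_)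
    · refine le_trans (le_of_eq ?_) (le_iSup _ (Fin.snoc (α := fun _ => Y) y z))
      rw [Fin.append_snoc]
    · have h := Fin.append_snoc u (Fin.init y) (y (Fin.last l))
      rw [Fin.snoc_init_self] at h
      rw [h]
      exact le_trans (le_iSup (fun z => φ.eval M (Fin.snoc (Fin.append u (Fin.init y)) z)) _)
        (le_iSup (fun y : Fin l → Y => (supVar φ).eval M (Fin.append u y)) (Fin.init y))

lemma modulus_supVars {k : ℕ} : ∀ {l : ℕ} (φ : PreFormula L (k + l)) (t : Fin k → ℝ≥0∞),
    (φ.supVars l).modulus t = φ.modulus (Fin.append t (fun _ : Fin l => 0))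
  | 0, φ, t => by
    rw [supVars]
    congr 1
    rw [Subsingleton.elim (fun _ : Fin 0 => (0 : ℝ≥0∞)) Fin.elim0, Fin.append_elim0]; rfl
  | l + 1, φ, t => by
    rw [supVars, modulus_supVars, modulus, ← Fin.append_snoc]
    congr 2
    funext i
    refine Fin.lastCases ?_ (fun i => ?_) i <;> simp

end PreFormula

/-! ### Truncation and suprema in the unit interval -/

lemma coe_truncUnit (x : ℝ) : (truncUnit x : ℝ) = max 0 (min 1 x) := by
  simp [truncUnit, Set.coe_projIcc]

lemma coe_truncUnit_of_mem {x : ℝ} (h0 : 0 ≤ x) (h1 : x ≤ 1) : (truncUnit x : ℝ) = x := by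
  simp [coe_truncUnit, h0, h1]

lemma continuous_truncUnit : Continuous truncUnit :=
  continuous_projIcc (h := zero_le_one)

lemma dist_truncUnit_le (x y : ℝ) : dist (truncUnit x) (truncUnit y) ≤ |x - y| := by
  rw [Subtype.dist_eq, Real.dist_eq]
  exact Set.abs_projIcc_sub_projIcc zero_le_one

lemma lt_truncUnit_iff {s : unitInterval} {x : ℝ} (hx : x ≤ 1) :
    s < truncUnit x ↔ (s : ℝ) < x := by
  rw [← Subtype.coe_lt_coe, coe_truncUnit, min_eq_right hx, lt_max_iff]
  exact ⟨fun h => h.resolve_left (not_lt.mpr s.2.1), Or.inr⟩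

lemma coe_truncUnit_le {x c : ℝ} (hc : 0 ≤ c) (h : x ≤ c) : (truncUnit x : ℝ) ≤ c := by
  rw [coe_truncUnit]
  exact max_le hc ((min_le_right _ _).trans h)

lemma le_coe_truncUnit {x : ℝ} (hx : x ≤ 1) : x ≤ (truncUnit x : ℝ) := by
  rw [coe_truncUnit, min_eq_right hx]
  exact le_max_right _ _

namespace unitInterval

lemma coe_iSup_le {ι : Sort*} {f : ι → unitInterval} {c : ℝ} (hc : 0 ≤ c)
    (h : ∀ i, (f i : ℝ) ≤ c) : ((⨆ i, f i : unitInterval) : ℝ) ≤ c := by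
  have : (⨆ i, f i) ≤ truncUnit c := iSup_le fun i =>
    Subtype.coe_le_coe.mp (by rw [coe_truncUnit]; exact le_max_of_le_right (le_min (f i).2.2 (h i)))
  exact le_trans (Subtype.coe_le_coe.mpr this) (coe_truncUnit_le hc le_rfl)

lemma le_coe_iSup {ι : Sort*} (f : ι → unitInterval) (i : ι) :
    (f i : ℝ) ≤ ((⨆ i, f i : unitInterval) : ℝ) :=
  Subtype.coe_le_coe.mpr (le_iSup f i)

lemma coe_iInf_le {ι : Sort*} (f : ι → unitInterval) (i : ι) :
    ((⨅ i, f i : unitInterval) : ℝ) ≤ (f i : ℝ) :=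
  Subtype.coe_le_coe.mpr (iInf_le f i)

lemma le_coe_iInf {ι : Sort*} {f : ι → unitInterval} {c : ℝ} (hc : c ≤ 1)
    (h : ∀ i, c ≤ (f i : ℝ)) : c ≤ ((⨅ i, f i : unitInterval) : ℝ) := by
  have : truncUnit c ≤ (⨅ i, f i) := le_iInf fun i =>
    Subtype.coe_le_coe.mp (coe_truncUnit_le (f i).2.1 (h i))
  exact (le_coe_truncUnit hc).trans (Subtype.coe_le_coe.mpr this)

end unitInterval

/-! ### Definable grey relations -/

section Definable

variable {L : MetricLanguage.{u, v}} {U : Type w} [MetricSpace U]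

/-- A grey relation `F` in a structure and a `k`-tuple is definable if some formula with `k` free
variables takes the values of `F` in all structures. -/
def IsDefinable {k : ℕ} (F : MetricModel L U → (Fin k → U) → unitInterval) : Prop :=
  ∃ φ : PreFormula L k, φ.WellFormed ∧ ∀ M u, φ.eval M u = F M u

/-- The grey relation `F` is `N`-Lipschitz in the tuple, with respect to the maximum metric. This
concerns the values of `F` only, not the modulus of a formula that defines it. -/
def IsValueLipschitz {k : ℕ} (N : ℕ) (F : MetricModel L U → (Fin k → U) → unitInterval) : Prop :=
  ∀ M u u', (F M u : ℝ) ≤ F M u' + N * dist u u'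

lemma IsValueLipschitz.iSup {k N : ℕ} {ι : Sort*}
    {F : ι → MetricModel L U → (Fin k → U) → unitInterval} (h : ∀ i, IsValueLipschitz N (F i)) :
    IsValueLipschitz N (fun M u => ⨆ i, F i M u) := by
  intro M u u'
  refine unitInterval.coe_iSup_le (add_nonneg (unitInterval.nonneg _) (by positivity)) fun i => ?_
  exact (h i M u u').trans (by gcongr; exact unitInterval.le_coe_iSup (fun i => F i M u') i)

lemma IsValueLipschitz.iInf {k N : ℕ} {ι : Sort*}
    {F : ι → MetricModel L U → (Fin k → U) → unitInterval} (h : ∀ i, IsValueLipschitz N (F i)) :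
    IsValueLipschitz N (fun M u => ⨅ i, F i M u) := by
  intro M u u'
  rw [← sub_le_iff_le_add]
  refine unitInterval.le_coe_iInf
    ((sub_le_self _ (by positivity)).trans (unitInterval.le_one _)) fun i => ?_
  rw [sub_le_iff_le_add]
  exact (unitInterval.coe_iInf_le (fun i => F i M u) i).trans (h i M u u')

namespace IsDefinable

lemma rename {k m : ℕ} {F : MetricModel L U → (Fin k → U) → unitInterval} (hF : IsDefinable F)
    (f : Fin k → Fin m) : IsDefinable (fun M (u : Fin m → U) => F M (fun i => u (f i))) := by
  obtain ⟨φ, hφ, hφF⟩ := hF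
  exact ⟨φ.rename f, hφ.rename f, fun M u => (φ.eval_rename M f u).trans (hφF M _)⟩

lemma comp {k : ℕ} {ι : Type*} [Finite ι] {h : (ι → unitInterval) → unitInterval}
    (hh : Continuous h) {F : ι → MetricModel L U → (Fin k → U) → unitInterval}
    (hF : ∀ i, IsDefinable (F i)) : IsDefinable (fun M u => h (fun i => F i M u)) := by
  choose φ hφ hφF using hF
  obtain ⟨m, ⟨e⟩⟩ := Finite.exists_equiv_fin ι
  have hc : Continuous fun x : Fin m → unitInterval => h (fun i => x (e i)) := by fun_prop
  exact ⟨.conn ⟨_, hc⟩ (fun j => φ (e.symm j)),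
    fun j => hφ (e.symm j), fun M u => by simp [PreFormula.eval, hφF]⟩

lemma distVar {k : ℕ} (i j : Fin k) :
    IsDefinable (fun (_ : MetricModel L U) (u : Fin k → U) => truncUnit (dist (u i) (u j))) :=
  ⟨.dist (.var i) (.var j), trivial, fun _ _ => rfl⟩

lemma iSup_append {k l : ℕ} {F : MetricModel L U → (Fin (k + l) → U) → unitInterval}
    (hF : IsDefinable F) : IsDefinable (fun M u => ⨆ y : Fin l → U, F M (Fin.append u y)) := by
  obtain ⟨φ, hφ, hφF⟩ := hF
  exact ⟨φ.supVars l, hφ.supVars, fun M u =>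
    (φ.eval_supVars M u).trans (iSup_congr fun y => hφF M (Fin.append u y))⟩

end IsDefinable

/-- The connective `(x_0, x_1, …, x_k) ↦ x_0 - N max_i x_{i+1}`, truncated. -/
noncomputable def penalize (N k : ℕ) : C(Fin (k + 1) → unitInterval, unitInterval) where
  toFun x := truncUnit ((x 0 : ℝ) - N * dist (fun i : Fin k => x i.succ) (fun _ => 0))
  continuous_toFun := by
    apply continuous_truncUnit.comp
    fun_prop

/-- The formula `sup_y (φ(y) - N d(x, y))`. It is `N`-Lipschitz whatever the modulus of `φ` is,
because the variables that occur in `φ` are bound. -/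
noncomputable def PreFormula.regularize (N : ℕ) {k : ℕ} (φ : PreFormula L k) : PreFormula L k :=
  supVars k (conn (penalize N k) (Fin.cons (α := fun _ => PreFormula L (k + k))
    (φ.rename (Fin.natAdd k)) (fun i => dist (.var (Fin.castAdd k i)) (.var (Fin.natAdd k i)))))

lemma PreFormula.WellFormed.regularize {k : ℕ} {φ : PreFormula L k} (h : φ.WellFormed) (N : ℕ) :
    (φ.regularize N).WellFormed := by
  refine WellFormed.supVars fun i => ?_
  refine Fin.cases ?_ (fun i => ?_) i
  · exact h.rename _
  · trivial

lemma PreFormula.modulus_regularize_le (N : ℕ) {k : ℕ} (φ : PreFormula L k) (t : ℝ≥0) :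
    (φ.regularize N).modulus (fun _ => (t : ℝ≥0∞)) ≤ (N : ℝ≥0∞) * t := by
  rw [regularize, modulus_supVars, modulus]
  refine iSup_le fun x => iSup_le fun y => iSup_le fun hxy => ?_
  have h0 : x 0 = y 0 := by
    have := hxy 0
    simp only [Fin.cons_zero, modulus_rename, Fin.append_right, modulus_zero] at this
    exact edist_le_zero.mp this
  have h1 : Dist.dist (fun i : Fin k => x i.succ) (fun i : Fin k => y i.succ) ≤ t := by
    refine (dist_pi_le_iff t.2).mpr fun i => ?_
    have := hxy i.succ
    simp only [Fin.cons_succ, modulus, MetricTerm.modulus, Fin.append_left, Fin.append_right,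
      add_zero, edist_nndist] at this
    exact_mod_cast this
  have h2 : Dist.dist (penalize N k x) (penalize N k y) ≤ (N : ℝ) * t := by
    refine (dist_truncUnit_le _ _).trans ?_
    rw [h0, sub_sub_sub_cancel_left, ← mul_sub, abs_mul, Nat.abs_cast]
    gcongr
    rw [abs_sub_comm]
    exact (abs_dist_sub_le _ _ _).trans h1
  rw [edist_nndist]
  exact_mod_cast h2

lemma dist_truncUnit_dist_zero (hd : ∀ x y : U, dist x y ≤ 1) {ι : Type*} [Fintype ι]
    (u u' : ι → U) :
    dist (fun i => truncUnit (dist (u i) (u' i))) (fun _ => 0) = dist u u' := by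
  have h : ∀ i, dist (truncUnit (dist (u i) (u' i))) 0 = dist (u i) (u' i) := fun i => by
    rw [Subtype.dist_eq, coe_truncUnit_of_mem dist_nonneg (hd _ _)]
    simp [abs_of_nonneg]
  refine le_antisymm ((dist_pi_le_iff dist_nonneg).mpr fun i => ?_)
    ((dist_pi_le_iff dist_nonneg).mpr fun i => ?_)
  · exact (h i).trans_le (dist_le_pi_dist u u' i)
  · exact (h i).symm.trans_le
      (dist_le_pi_dist (fun i => truncUnit (dist (u i) (u' i))) (fun _ => 0) i)

/-- A definable grey relation with `N`-Lipschitz values is defined by an `N`-Lipschitz formula. -/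
lemma IsDefinable.exists_isLipschitz (hd : ∀ x y : U, dist x y ≤ 1) {k N : ℕ}
    {F : MetricModel L U → (Fin k → U) → unitInterval} (hF : IsDefinable F)
    (hN : IsValueLipschitz N F) :
    ∃ φ : PreFormula L k, φ.WellFormed ∧
      (∀ t : ℝ≥0, φ.modulus (fun _ => (t : ℝ≥0∞)) ≤ (N : ℝ≥0∞) * t) ∧
      ∀ M u, φ.eval M u = F M u := by
  obtain ⟨φ, hφ, hφF⟩ := hF
  refine ⟨φ.regularize N, hφ.regularize N, φ.modulus_regularize_le N, fun M u => ?_⟩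
  have key : ∀ y : Fin k → U, (PreFormula.conn (penalize N k)
      (Fin.cons (α := fun _ => PreFormula L (k + k)) (φ.rename (Fin.natAdd k))
        (fun i => .dist (.var (Fin.castAdd k i)) (.var (Fin.natAdd k i))))).eval M
        (Fin.append u y) = truncUnit (F M y - N * dist u y) := by
    intro y
    rw [← hφF]
    simp only [PreFormula.eval, penalize, ContinuousMap.coe_mk, Fin.cons_zero, Fin.cons_succ,
      PreFormula.eval_rename, Fin.append_right, Fin.append_left, MetricTerm.eval,
      dist_truncUnit_dist_zero hd]
  rw [PreFormula.regularize, PreFormula.eval_supVars, iSup_congr key]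
  refine le_antisymm (iSup_le fun y => ?_) ?_
  · refine Subtype.coe_le_coe.mp (coe_truncUnit_le (F M u).2.1 ?_)
    have := hN M y u
    rw [dist_comm] at this
    linarith
  · refine le_trans (Subtype.coe_le_coe.mp ?_) (le_iSup _ u)
    rw [dist_self, mul_zero, sub_zero]
    exact le_coe_truncUnit (unitInterval.le_one _)

lemma PreFormula.uniformlyBounded_of_isLipschitz {k N : ℕ} {φ : ℕ → PreFormula L k}
    (h : ∀ n (t : ℝ≥0), (φ n).modulus (fun _ => (t : ℝ≥0∞)) ≤ (N : ℝ≥0∞) * t) :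
    UniformlyBounded φ :=
  ⟨⟨fun t => N * t, by fun_prop, by simp⟩, fun n t => by simpa using h n t⟩

lemma IsDefinable.iSup (hd : ∀ x y : U, dist x y ≤ 1) {k N : ℕ}
    {F : ℕ → MetricModel L U → (Fin k → U) → unitInterval} (hF : ∀ n, IsDefinable (F n))
    (hN : ∀ n, IsValueLipschitz N (F n)) : IsDefinable (fun M u => ⨆ n, F n M u) := by
  choose φ hφ hφN hφF using fun n => (hF n).exists_isLipschitz hd (hN n)
  exact ⟨.supSeq φ, ⟨hφ, PreFormula.uniformlyBounded_of_isLipschitz hφN⟩,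
    fun M u => iSup_congr fun n => hφF n M u⟩

lemma IsDefinable.iInf (hd : ∀ x y : U, dist x y ≤ 1) {k N : ℕ}
    {F : ℕ → MetricModel L U → (Fin k → U) → unitInterval} (hF : ∀ n, IsDefinable (F n))
    (hN : ∀ n, IsValueLipschitz N (F n)) : IsDefinable (fun M u => ⨅ n, F n M u) := by
  choose φ hφ hφN hφF using fun n => (hF n).exists_isLipschitz hd (hN n)
  exact ⟨.infSeq φ, ⟨hφ, PreFormula.uniformlyBounded_of_isLipschitz hφN⟩,
    fun M u => iInf_congr fun n => hφF n M u⟩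

end Definable

/-! ### The isometry group -/

section IsometryGroup

open Filter Topology

variable {Y : Type w} [MetricSpace Y]

lemma continuous_isometryEquiv_apply (y : Y) : Continuous fun g : Y ≃ᵢ Y => g y :=
  (continuous_apply y).comp continuous_induced_dom

lemma tendsto_isometryEquiv_iff {α : Type*} {l : Filter α} {g : α → Y ≃ᵢ Y} {g₀ : Y ≃ᵢ Y} :
    Tendsto g l (𝓝 g₀) ↔ ∀ y, Tendsto (fun a => g a y) l (𝓝 (g₀ y)) := by
  rw [nhds_induced, tendsto_comap_iff, tendsto_pi_nhds]
  rfl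

lemma tendsto_isometryEquiv_iff_of_denseRange {p : ℕ → Y} (hp : DenseRange p) {α : Type*}
    {l : Filter α} {g : α → Y ≃ᵢ Y} {g₀ : Y ≃ᵢ Y} :
    Tendsto g l (𝓝 g₀) ↔ ∀ n, Tendsto (fun a => g a (p n)) l (𝓝 (g₀ (p n))) := by
  rw [tendsto_isometryEquiv_iff]
  refine ⟨fun h n => h (p n), fun h y => Metric.tendsto_nhds.mpr fun ε hε => ?_⟩
  obtain ⟨n, hn⟩ := hp.exists_dist_lt y (show (0 : ℝ) < ε / 3 by positivity)
  filter_upwards [Metric.tendsto_nhds.mp (h n) (ε / 3) (by positivity)] with a ha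
  calc dist (g a y) (g₀ y) ≤ dist (g a y) (g a (p n)) + dist (g a (p n)) (g₀ (p n))
        + dist (g₀ (p n)) (g₀ y) := dist_triangle4 _ _ _ _
    _ < ε := by rw [(g a).dist_eq, g₀.dist_eq, dist_comm (p n)]; linarith

lemma tendsto_isometryEquiv_inv {α : Type*} {l : Filter α} {g : α → Y ≃ᵢ Y} {g₀ : Y ≃ᵢ Y}
    (h : Tendsto g l (𝓝 g₀)) : Tendsto (fun a => (g a)⁻¹) l (𝓝 g₀⁻¹) := by
  rw [tendsto_isometryEquiv_iff] at h ⊢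
  intro y
  have := h (g₀⁻¹ y)
  rw [tendsto_iff_dist_tendsto_zero] at this ⊢
  refine this.congr fun a => ?_
  rw [← (g a).dist_eq ((g a)⁻¹ y), IsometryEquiv.apply_inv_self, dist_comm,
    IsometryEquiv.apply_inv_self]

lemma continuous_isometryEquiv_inv_apply (y : Y) : Continuous fun g : Y ≃ᵢ Y => g⁻¹ y :=
  continuous_iff_continuousAt.mpr fun _ =>
    tendsto_isometryEquiv_iff.mp (tendsto_isometryEquiv_inv tendsto_id) y

lemma Continuous.isometryEquiv_apply {X : Type*} [TopologicalSpace X] {g : X → Y ≃ᵢ Y} {f : X → Y}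
    (hg : Continuous g) (hf : Continuous f) : Continuous fun x => g x (f x) := by
  refine continuous_iff_continuousAt.mpr fun x₀ => ?_
  have h1 : Tendsto (fun x => dist (f x) (f x₀) + dist (g x (f x₀)) (g x₀ (f x₀))) (𝓝 x₀)
      (𝓝 0) := by
    have h2 := tendsto_iff_dist_tendsto_zero.mp (hf.tendsto x₀)
    have h3 := tendsto_iff_dist_tendsto_zero.mp
      (tendsto_isometryEquiv_iff.mp (hg.tendsto x₀) (f x₀))
    simpa using h2.add h3
  refine tendsto_iff_dist_tendsto_zero.mpr
    (squeeze_zero (fun _ => dist_nonneg) (fun x => ?_) h1)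
  refine (dist_triangle _ (g x (f x₀)) _).trans ?_
  rw [(g x).dist_eq]

/-- An isometry `g` is coded by the images under `g` and under `g⁻¹` of the points of a dense
sequence. -/
def isometryCode (p : ℕ → Y) (g : Y ≃ᵢ Y) : (ℕ → Y) × (ℕ → Y) :=
  (fun n => g (p n), fun n => g⁻¹ (p n))

lemma continuous_isometryCode (p : ℕ → Y) : Continuous (isometryCode p) :=
  (continuous_pi fun n => continuous_isometryEquiv_apply (p n)).prodMk
    (continuous_pi fun n => continuous_isometryEquiv_inv_apply (p n))

/-- If the values of isometries converge on a dense set, then they converge everywhere. -/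
lemma exists_tendsto_isometryEquiv_apply [CompleteSpace Y] {p : ℕ → Y} (hp : DenseRange p)
    {α : Type*} {l : Filter α} [l.NeBot] {g : α → Y ≃ᵢ Y} {x : ℕ → Y}
    (h : ∀ n, Tendsto (fun a => g a (p n)) l (𝓝 (x n))) (y : Y) :
    ∃ z, Tendsto (fun a => g a y) l (𝓝 z) := by
  refine cauchy_map_iff_exists_tendsto.mp (Metric.cauchy_iff.mpr ⟨inferInstance, fun ε hε => ?_⟩)
  obtain ⟨n, hn⟩ := hp.exists_dist_lt y (show (0 : ℝ) < ε / 4 by positivity)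
  refine ⟨Metric.ball (x n) (ε / 2), ?_, fun a ha b hb => ?_⟩
  · rw [mem_map]
    filter_upwards [Metric.tendsto_nhds.mp (h n) (ε / 4) (by positivity)] with a ha
    calc dist (g a y) (x n) ≤ dist (g a y) (g a (p n)) + dist (g a (p n)) (x n) :=
          dist_triangle _ _ _
      _ < ε / 2 := by rw [(g a).dist_eq]; linarith
  · calc dist a b ≤ dist a (x n) + dist b (x n) := dist_triangle_right _ _ _
      _ < ε := by rw [Metric.mem_ball] at ha hb; linarith

lemma isClosedEmbedding_isometryCode [CompleteSpace Y] {p : ℕ → Y} (hp : DenseRange p) :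
    IsClosedEmbedding (isometryCode p) := by
  refine ⟨⟨isInducing_iff_nhds.mpr fun g₀ => le_antisymm ?_ ?_, fun g g' h => ?_⟩, ?_⟩
  · exact (continuous_isometryCode p).continuousAt.tendsto.le_comap
  · have h : Tendsto id (comap (isometryCode p) (𝓝 (isometryCode p g₀))) (𝓝 g₀) := by
      rw [tendsto_isometryEquiv_iff_of_denseRange hp]
      intro n
      exact (((continuous_apply n).comp continuous_fst).tendsto (isometryCode p g₀)).comp
        tendsto_comap
    exact h
  · have : (g : Y → Y) = g' := hp.equalizer g.continuous g'.continuous (congrArg Prod.fst h)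
    exact DFunLike.coe_injective this
  · refine isClosed_of_closure_subset fun c hc => ?_
    have hne : (comap (isometryCode p) (𝓝 c)).NeBot := by
      rwa [comap_neBot_iff_frequently, ← mem_closure_iff_frequently]
    have hlim : Tendsto (isometryCode p) (comap (isometryCode p) (𝓝 c)) (𝓝 c) := tendsto_comap
    generalize comap (isometryCode p) (𝓝 c) = l at hne hlim
    have h1 : ∀ n, Tendsto (fun g : Y ≃ᵢ Y => g (p n)) l (𝓝 (c.1 n)) := fun n =>
      (((continuous_apply n).comp continuous_fst).tendsto c).comp hlim
    have h2 : ∀ n, Tendsto (fun g : Y ≃ᵢ Y => g⁻¹ (p n)) l (𝓝 (c.2 n)) := fun n =>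
      (((continuous_apply n).comp continuous_snd).tendsto c).comp hlim
    choose φ hφ using exists_tendsto_isometryEquiv_apply hp h1
    choose ψ hψ using exists_tendsto_isometryEquiv_apply hp h2
    -- The limits of `g` and of `g⁻¹` are adjoint, since `d(g y, z) = d(y, g⁻¹ z)`; hence they are
    -- isometries inverse to each other.
    have hadj : ∀ y z, dist (φ y) z = dist y (ψ z) := fun y z =>
      tendsto_nhds_unique (((hφ y).dist tendsto_const_nhds).congr fun g => by
        rw [← (g : Y ≃ᵢ Y).dist_eq y, IsometryEquiv.apply_inv_self])
        (tendsto_const_nhds.dist (hψ z))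
    have hφψ : ∀ z, φ (ψ z) = z := fun z => dist_eq_zero.mp (by rw [hadj, dist_self])
    have hψφ : ∀ y, ψ (φ y) = y := fun y => (dist_eq_zero.mp (by rw [← hadj, dist_self])).symm
    have hiso : Isometry φ := Isometry.of_dist_eq fun y z => by rw [hadj, hψφ]
    refine ⟨⟨⟨φ, ψ, hψφ, hφψ⟩, hiso⟩, Prod.ext (funext fun n => ?_) (funext fun n => ?_)⟩
    · exact tendsto_nhds_unique (hφ (p n)) (h1 n)
    · exact tendsto_nhds_unique (hψ (p n)) (h2 n)

lemma baireSpace_isometryEquiv [CompleteSpace Y] {p : ℕ → Y} (hp : DenseRange p) :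
    BaireSpace (Y ≃ᵢ Y) := by
  have : TopologicalSpace.SeparableSpace Y := ⟨⟨Set.range p, Set.countable_range p, hp⟩⟩
  have : PolishSpace (Y ≃ᵢ Y) := (isClosedEmbedding_isometryCode hp).polishSpace
  infer_instance

/-- The tuple of the preimages of the first `k` points of the sequence `p` under an isometry. -/
abbrev preimageTuple (p : ℕ → Y) (k : ℕ) (g : Y ≃ᵢ Y) : Fin k → Y := fun i => g⁻¹ (p i)

lemma continuous_preimageTuple (p : ℕ → Y) (k : ℕ) : Continuous (preimageTuple p k) :=
  continuous_pi fun i => continuous_isometryEquiv_inv_apply (p i)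

/-- The sets `{g | d(g⁻¹ p, g₀⁻¹ p) < δ}`, with `p` an initial segment of a dense sequence that may
be taken as long as desired, form a neighbourhood basis at `g₀`. -/
lemma exists_preimageTuple_subset {p : ℕ → Y} (hp : DenseRange p) (k : ℕ) {W : Set (Y ≃ᵢ Y)}
    (hW : IsOpen W) {g₀ : Y ≃ᵢ Y} (hg₀ : g₀ ∈ W) : ∃ j : ℕ, ∃ δ : ℝ, 0 < δ ∧
      {g | dist (preimageTuple p (k + j) g) (preimageTuple p (k + j) g₀) < δ} ⊆ W := by
  -- Otherwise there are `g j ∉ W` whose inverses converge on `p` to `g₀⁻¹`, so `g j → g₀ ∈ W`.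
  by_contra! hcon
  have hpos : ∀ j : ℕ, (0 : ℝ) < 1 / ((j : ℝ) + 1) := fun j => by positivity
  choose g hg hgW using fun j => Set.not_subset.mp (hcon j _ (hpos j))
  have hinv : Tendsto (fun j => (g j)⁻¹) atTop (𝓝 g₀⁻¹) := by
    rw [tendsto_isometryEquiv_iff_of_denseRange hp]
    intro n
    rw [tendsto_iff_dist_tendsto_zero]
    refine squeeze_zero' (Eventually.of_forall fun _ => dist_nonneg) ?_
      tendsto_one_div_add_atTop_nhds_zero_nat
    filter_upwards [eventually_gt_atTop n] with j hj
    exact (dist_le_pi_dist (preimageTuple p (k + j) (g j)) (preimageTuple p (k + j) g₀)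
      ⟨n, by omega⟩).trans (le_of_lt (hg j))
  have hlim := tendsto_isometryEquiv_inv hinv
  simp only [inv_inv] at hlim
  obtain ⟨j, hj⟩ := (hlim.eventually (hW.mem_nhds hg₀)).exists
  exact hgW j hj

end IsometryGroup

/-! ### Baire category -/

/-- A set with the Baire property is nonmeagre in an open set if and only if it is comeagre in some
nonempty open subset. -/
lemma not_isMeagre_inter_iff {X : Type*} [TopologicalSpace X] [BaireSpace X] {T V : Set X}
    (hT : BaireMeasurableSet T) (hV : IsOpen V) :
    ¬ IsMeagre (T ∩ V) ↔ ∃ W ⊆ V, IsOpen W ∧ W.Nonempty ∧ IsMeagre (W \ T) := by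
  constructor
  · intro h
    obtain ⟨O, hO, hTO⟩ := hT.residualEq_isOpen
    rw [Filter.eventuallyEq_set] at hTO
    refine ⟨O ∩ V, Set.inter_subset_right, hO.inter hV, ?_, ?_⟩
    · by_contra hne
      refine h (Filter.mem_of_superset hTO fun x hx hxTV => hne ⟨x, hx.mp hxTV.1, hxTV.2⟩)
    · exact Filter.mem_of_superset hTO fun x hx hxW => hxW.2 (hx.mpr hxW.1.1)
  · rintro ⟨W, hWV, hW, hne, hm⟩ hTV
    refine not_isMeagre_of_isOpen hW hne ((hTV.union hm).mono fun x hx => ?_)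
    by_cases hxT : x ∈ T
    · exact Or.inl ⟨hxT, hWV hx⟩
    · exact Or.inr ⟨hx, hxT⟩

/-! ### Continuity of the action on structures -/

section Action

open Filter Topology

variable {L : MetricLanguage.{u, v}} {Y : Type w} [MetricSpace Y]

lemma ContModulus.tendsto_nndist {ι : Type*} [Fintype ι] (w : ContModulus) {α : Type*}
    {l : Filter α} {a : α → ι → Y} {b : ι → Y} (h : Tendsto a l (𝓝 b)) :
    Tendsto (fun x => (w.toFun (nndist (a x) b) : ℝ)) l (𝓝 0) := by
  have h1 : Tendsto (fun x => nndist (a x) b) l (𝓝 0) := by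
    simpa using h.nndist (tendsto_const_nhds (x := b))
  have h2 := (w.continuous_toFun.tendsto 0).comp h1
  rw [w.map_zero] at h2
  exact NNReal.tendsto_coe.mpr h2

namespace MetricModel

lemma continuous_func (M : MetricModel L Y) (f : L.Func) : Continuous (M.func f) :=
  continuous_iff_continuousAt.mpr fun b => tendsto_iff_dist_tendsto_zero.mpr <|
    squeeze_zero (fun _ => dist_nonneg) (fun a => by exact_mod_cast M.func_modulus f a b)
      ((L.funcModulus f).tendsto_nndist tendsto_id)

lemma continuous_rel (M : MetricModel L Y) (R : L.Rel) : Continuous (M.rel R) :=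
  continuous_iff_continuousAt.mpr fun b => tendsto_iff_dist_tendsto_zero.mpr <|
    squeeze_zero (fun _ => dist_nonneg) (fun a => by exact_mod_cast M.rel_modulus R a b)
      ((L.relModulus R).tendsto_nndist tendsto_id)

lemma continuous_smul (M : MetricModel L Y) : Continuous fun g : Y ≃ᵢ Y => g • M := by
  refine continuous_induced_rng.mpr (Continuous.prodMk ?_ ?_)
  · refine continuous_pi fun f => continuous_pi fun a => ?_
    exact continuous_id.isometryEquiv_apply ((M.continuous_func f).comp
      (continuous_pi fun i => continuous_isometryEquiv_inv_apply (a i)))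
  · refine continuous_pi fun R => continuous_pi fun a => ?_
    exact (M.continuous_rel R).comp
      (continuous_pi fun i => continuous_isometryEquiv_inv_apply (a i))

lemma baireMeasurableSet_smul_mem (M : MetricModel L Y) {B : Set (MetricModel L Y)}
    (hB : MeasurableSet B) : BaireMeasurableSet {g : Y ≃ᵢ Y | g • M ∈ B} := by
  borelize (Y ≃ᵢ Y)
  exact (M.continuous_smul.measurable hB).baireMeasurableSet

end MetricModel

end Action

/-! ### Orbits of tuples in the Urysohn sphere -/

section Orbit

variable {U : Type w} [MetricSpace U]

lemma IsUrysohnSphere.exists_dist_eq (hU : IsUrysohnSphere U) {X : Type} [Countable X]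
    [PseudoMetricSpace X] (h : ∀ x y : X, dist x y ≤ 1) :
    ∃ f : X → U, ∀ x y, dist (f x) (f y) = dist x y := by
  have : Countable (SeparationQuotient X) := SeparationQuotient.surjective_mk.countable
  obtain ⟨f, hf⟩ := hU.universal (SeparationQuotient X) (by
    intro x y
    obtain ⟨x, rfl⟩ := SeparationQuotient.surjective_mk x
    obtain ⟨y, rfl⟩ := SeparationQuotient.surjective_mk y
    rw [SeparationQuotient.dist_mk]
    exact h x y)
  exact ⟨fun x => f (SeparationQuotient.mk x), fun x y => by
    rw [hf.dist_eq, SeparationQuotient.dist_mk]⟩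

/-- Two finite tuples of the Urysohn sphere whose distance matrices differ by at most `2 ε` are
within `ε` of each other up to an isometry: glue two copies of the space along the tuples, embed
the finite space obtained from the two tuples, and move the copies back. -/
lemma IsUrysohnSphere.exists_dist_le (hU : IsUrysohnSphere U) {n : ℕ} (a b : Fin n → U) {ε : ℝ}
    (hε : 0 < ε) (h : ∀ i j, |dist (a i) (a j) - dist (b i) (b j)| ≤ 2 * ε) :
    ∃ g : U ≃ᵢ U, dist (fun i => g (b i)) a ≤ ε := by
  rcases isEmpty_or_nonempty (Fin n) with hn | hn
  · exact ⟨1, (dist_pi_le_iff hε.le).mpr fun i => hn.elim i⟩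
  let G : MetricSpace (U ⊕ U) := Metric.glueMetricApprox a b ε hε h
  let P : PseudoMetricSpace (Fin n ⊕ Fin n) :=
    { dist := fun x y => min 1 (G.dist (Sum.map a b x) (Sum.map a b y))
      dist_self := fun x => by rw [G.dist_self]; norm_num
      dist_comm := fun x y => by rw [G.dist_comm]
      dist_triangle := fun x y z => by
        have h1 := G.dist_triangle (Sum.map a b x) (Sum.map a b y) (Sum.map a b z)
        have h2 : 0 ≤ G.dist (Sum.map a b x) (Sum.map a b y) := 
          @dist_nonneg _ G.toPseudoMetricSpace _ _
        have h3 : 0 ≤ G.dist (Sum.map a b y) (Sum.map a b z) := 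
          @dist_nonneg _ G.toPseudoMetricSpace _ _
        rcases min_cases 1 (G.dist (Sum.map a b x) (Sum.map a b y)) with h4 | h4 <;>
        rcases min_cases 1 (G.dist (Sum.map a b y) (Sum.map a b z)) with h5 | h5 <;>
        rcases min_cases 1 (G.dist (Sum.map a b x) (Sum.map a b z)) with h6 | h6 <;>
        linarith }
  obtain ⟨f, hf⟩ := IsUrysohnSphere.exists_dist_eq hU (X := Fin n ⊕ Fin n)
    fun x y => min_le_left _ _
  have hdist : ∀ x y : Fin n ⊕ Fin n, dist (f x) (f y) =
      min 1 (Metric.glueDist a b ε (Sum.map a b x) (Sum.map a b y)) := hf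
  obtain ⟨g₁, hg₁⟩ := hU.ultrahomogeneous n (fun i => f (Sum.inl i)) a
    fun i j => (hdist _ _).trans (min_eq_right (hU.dist_le_one _ _))
  obtain ⟨g₂, hg₂⟩ := hU.ultrahomogeneous n b (fun i => f (Sum.inr i))
    fun i j => ((hdist (.inr i) (.inr j)).trans
      (min_eq_right (hU.dist_le_one (b i) (b j)))).symm
  refine ⟨g₁ * g₂, (dist_pi_le_iff hε.le).mpr fun i => ?_⟩
  rw [IsometryEquiv.mul_apply, hg₂, ← hg₁, g₁.dist_eq, dist_comm, hdist, Sum.map_inl, Sum.map_inr,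
    Metric.glueDist_glued_points]
  exact min_le_right _ _

/-- The difference between the distance matrix of a tuple `w` and that of the first `l` points of
the sequence `p`. It vanishes on the orbit of these points, and is small only near the orbit. -/
noncomputable def orbitDefect (p : ℕ → U) (l : ℕ) (w : Fin l → U) : ℝ :=
  dist (fun ij : Fin l × Fin l => truncUnit (dist (w ij.1) (w ij.2)))
    (fun ij : Fin l × Fin l => truncUnit (dist (p ij.1) (p ij.2)))

lemma orbitDefect_nonneg (p : ℕ → U) (l : ℕ) (w : Fin l → U) : 0 ≤ orbitDefect p l w :=
  dist_nonneg

lemma orbitDefect_preimageTuple (p : ℕ → U) (l : ℕ) (g : U ≃ᵢ U) :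
    orbitDefect p l (preimageTuple p l g) = 0 := by
  simp [orbitDefect, preimageTuple, g⁻¹.dist_eq]

lemma IsUrysohnSphere.exists_preimageTuple_dist_le (hU : IsUrysohnSphere U) (p : ℕ → U) {l : ℕ}
    {w : Fin l → U} {δ : ℝ} (hδ : 0 < δ) (h : orbitDefect p l w ≤ δ) :
    ∃ g : U ≃ᵢ U, dist (preimageTuple p l g) w ≤ δ := by
  obtain ⟨g, hg⟩ := hU.exists_dist_le w (fun i : Fin l => p i) hδ fun i j => by
    have := (dist_le_pi_dist (fun ij : Fin l × Fin l => truncUnit (dist (w ij.1) (w ij.2)))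
      (fun ij : Fin l × Fin l => truncUnit (dist (p ij.1) (p ij.2))) (i, j)).trans h
    simp only [Subtype.dist_eq, Real.dist_eq,
      coe_truncUnit_of_mem dist_nonneg (hU.dist_le_one _ _)] at this
    linarith
  refine ⟨g⁻¹, ?_⟩
  have : preimageTuple p l g⁻¹ = fun i : Fin l => g (p i) := by
    funext i
    exact congrArg (fun h : U ≃ᵢ U => h (p i)) (inv_inv g)
  rwa [this]

end Orbit

/-! ### Quantification over an orbit -/

section OrbitQuantifier

variable {L : MetricLanguage.{u, v}} {U : Type w} [MetricSpace U]

/-- The grey relation `Θ` is uniformly continuous in the tuple, uniformly in the structure. -/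
def IsEquicontinuous {l : ℕ} (Θ : MetricModel L U → (Fin l → U) → unitInterval) : Prop :=
  ∀ η : ℝ, 0 < η → ∃ δ : ℝ, 0 < δ ∧
    ∀ M w w', dist w w' ≤ δ → (Θ M w : ℝ) ≤ Θ M w' + η

lemma isValueLipschitz_truncUnit_sub {k : ℕ} (N : ℕ) (c : MetricModel L U → ℝ) (hc : ∀ M, c M ≤ 1)
    (x : MetricModel L U → Fin k → U) :
    IsValueLipschitz N (fun M u => truncUnit (c M - N * dist (x M) u)) := by
  intro M u u'
  have h1 : c M - N * dist (x M) u' ≤ 1 :=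
    (sub_le_self _ (by positivity)).trans (hc M)
  have h2 := le_coe_truncUnit h1
  refine coe_truncUnit_le (add_nonneg (unitInterval.nonneg _) (by positivity)) ?_
  have h3 : (N : ℝ) * dist (x M) u' ≤ N * (dist (x M) u + dist u u') := by
    gcongr
    exact dist_triangle _ _ _
  linarith

/-- The quantity `min(r, m Θ(w)) - N d(w|k, u)` whose supremum over the orbit is sought, with a
penalty of slope `K` for tuples `w` that are not in the orbit. -/
noncomputable def orbitPenalty (p : ℕ → U) (k j N : ℕ) (r : unitInterval)
    (Θ : MetricModel L U → (Fin (k + j) → U) → unitInterval) (m K : ℕ) (M : MetricModel L U)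
    (u : Fin k → U) (w : Fin (k + j) → U) : ℝ :=
  min (r : ℝ) (m * Θ M w) - N * dist (fun i => w (Fin.castAdd j i)) u - K * orbitDefect p (k + j) w

lemma isDefinable_iSup_orbitPenalty (hd : ∀ x y : U, dist x y ≤ 1) (p : ℕ → U) {k j : ℕ} (N : ℕ)
    (r : unitInterval) {Θ : MetricModel L U → (Fin (k + j) → U) → unitInterval}
    (hΘ : IsDefinable Θ) (m K : ℕ) :
    IsDefinable (fun M u => ⨆ w : Fin (k + j) → U,
      truncUnit (orbitPenalty p k j N r Θ m K M u w)) := by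
  let h : (Unit ⊕ Fin k ⊕ Fin (k + j) × Fin (k + j) → unitInterval) → unitInterval := fun x =>
    truncUnit (min (r : ℝ) (m * x (.inl ())) - N * dist (fun i => x (.inr (.inl i))) (fun _ => 0)
      - K * dist (fun ij => x (.inr (.inr ij)))
        (fun ij : Fin (k + j) × Fin (k + j) => truncUnit (dist (p ij.1) (p ij.2))))
  have hh : Continuous h := by
    apply continuous_truncUnit.comp
    fun_prop
  let F : Unit ⊕ Fin k ⊕ Fin (k + j) × Fin (k + j) →
      MetricModel L U → (Fin (k + (k + j)) → U) → unitInterval :=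
    Sum.elim (fun _ M x => Θ M (fun i => x (Fin.natAdd k i)))
      (Sum.elim
        (fun i _ x => truncUnit (dist (x (Fin.natAdd k (Fin.castAdd j i))) (x (Fin.castAdd _ i))))
        (fun ij _ x => truncUnit (dist (x (Fin.natAdd k ij.1)) (x (Fin.natAdd k ij.2)))))
  have hF : ∀ i, IsDefinable (F i) := by
    rintro (_ | i | ij)
    · exact hΘ.rename _
    · exact IsDefinable.distVar _ _
    · exact IsDefinable.distVar _ _
  have := (IsDefinable.comp hh hF).iSup_append
  refine (congrArg IsDefinable (funext fun M => funext fun u => iSup_congr fun w => ?_)).mp this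
  simp only [h, F, Sum.elim_inl, Sum.elim_inr, Fin.append_left, Fin.append_right,
    dist_truncUnit_dist_zero hd, orbitPenalty, orbitDefect]

lemma isValueLipschitz_iSup_orbitPenalty (p : ℕ → U) (k j N : ℕ) (r : unitInterval)
    (Θ : MetricModel L U → (Fin (k + j) → U) → unitInterval) (m K : ℕ) :
    IsValueLipschitz N (fun M u => ⨆ w : Fin (k + j) → U,
      truncUnit (orbitPenalty p k j N r Θ m K M u w)) := by
  refine IsValueLipschitz.iSup fun w => ?_
  have := isValueLipschitz_truncUnit_sub N
    (fun M => min (r : ℝ) (m * Θ M w) - K * orbitDefect p (k + j) w)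
    (fun M => (sub_le_self _ (mul_nonneg (Nat.cast_nonneg _) (orbitDefect_nonneg _ _ _))).trans
      ((min_le_left _ _).trans r.2.2)) (fun _ i => w (Fin.castAdd j i))
  refine (congrArg (IsValueLipschitz N) (funext fun M => funext fun u => ?_)).mp this
  rw [orbitPenalty, sub_right_comm]

/-- The supremum over an orbit is the limit of the suprema over the whole space with an increasing
penalty for not being in the orbit. This holds because a tuple with small defect is close to the
orbit, where the equicontinuity of `Θ` applies. -/
lemma IsUrysohnSphere.iSup_orbit_eq (hU : IsUrysohnSphere U) (p : ℕ → U) {k j : ℕ} (N : ℕ)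
    (r : unitInterval) {Θ : MetricModel L U → (Fin (k + j) → U) → unitInterval}
    (hΘ : IsEquicontinuous Θ) (m : ℕ) (M : MetricModel L U) (u : Fin k → U) :
    ⨅ K : ℕ, ⨆ w : Fin (k + j) → U, truncUnit (orbitPenalty p k j N r Θ m K M u w) =
      ⨆ g : U ≃ᵢ U, truncUnit (min (r : ℝ) (m * Θ M (preimageTuple p (k + j) g))
        - N * dist (preimageTuple p k g) u) := by
  refine le_antisymm ?_ (le_iInf fun K => iSup_le fun g =>
    le_trans (le_of_eq ?_) (le_iSup _ (preimageTuple p (k + j) g)))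
  · refine Subtype.coe_le_coe.mp (le_of_forall_pos_le_add fun η hη => ?_)
    obtain ⟨δ₀, hδ₀, h₀⟩ := hΘ (η / (2 * (m + 1))) (by positivity)
    -- Below `δ`, neither of the terms `m Θ` and `N d` changes by more than `η / 2`.
    set δ := min δ₀ (η / (2 * (N + 1))) with hδ
    have hδpos : 0 < δ := lt_min hδ₀ (by positivity)
    -- A tuple whose defect exceeds `δ` pays a penalty of at least `1` and does not count.
    obtain ⟨K, hK⟩ := exists_nat_gt (1 / δ)
    rw [div_lt_iff₀ hδpos] at hK
    refine (unitInterval.coe_iInf_le _ K).trans (unitInterval.coe_iSup_le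
      (add_nonneg (unitInterval.nonneg _) hη.le) fun w => coe_truncUnit_le
        (add_nonneg (unitInterval.nonneg _) hη.le) ?_)
    rcases le_or_gt (orbitDefect p (k + j) w) δ with hw | hw
    · obtain ⟨g, hg⟩ := hU.exists_preimageTuple_dist_le p hδpos hw
      have h1 : orbitPenalty p k j N r Θ m K M u w ≤ min (r : ℝ)
          (m * Θ M (preimageTuple p (k + j) g)) - N * dist (preimageTuple p k g) u + η := by
        have h2 : (m : ℝ) * Θ M w ≤ m * Θ M (preimageTuple p (k + j) g) + η / 2 := by
          have h3 := h₀ M w (preimageTuple p (k + j) g)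
            (by rw [dist_comm]; exact hg.trans (min_le_left _ _))
          have h4 : (m : ℝ) * (η / (2 * (m + 1))) ≤ η / 2 := by
            rw [mul_div_assoc', div_le_div_iff₀ (by positivity) (by positivity)]
            nlinarith
          nlinarith [mul_le_mul_of_nonneg_left h3 (Nat.cast_nonneg (α := ℝ) m)]
        have h5 : (N : ℝ) * dist (preimageTuple p k g) u ≤
            N * dist (fun i => w (Fin.castAdd j i)) u + η / 2 := by
          have h6 : dist (preimageTuple p k g) (fun i => w (Fin.castAdd j i)) ≤
              η / (2 * (N + 1)) :=
            (dist_pi_le_iff (by positivity)).mpr fun i =>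
              (dist_le_pi_dist (preimageTuple p (k + j) g) w (Fin.castAdd j i)).trans
                (hg.trans (min_le_right _ _))
          have h7 : (N : ℝ) * (η / (2 * (N + 1))) ≤ η / 2 := by
            rw [mul_div_assoc', div_le_div_iff₀ (by positivity) (by positivity)]
            nlinarith
          have h8 := dist_triangle (preimageTuple p k g) (fun i => w (Fin.castAdd j i)) u
          nlinarith [mul_le_mul_of_nonneg_left (h8.trans (add_le_add_left h6 _))
            (Nat.cast_nonneg (α := ℝ) N)]
        have h9 : 0 ≤ (K : ℝ) * orbitDefect p (k + j) w :=
          mul_nonneg (Nat.cast_nonneg _) (orbitDefect_nonneg _ _ _)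
        have h10 : min (r : ℝ) (m * Θ M w) ≤
            min (r : ℝ) (m * Θ M (preimageTuple p (k + j) g)) + η / 2 := by
          rw [← min_add_add_right]
          exact min_le_min (by linarith) h2
        rw [orbitPenalty]
        linarith
      refine h1.trans (add_le_add_left (le_trans ?_ (unitInterval.le_coe_iSup _ g)) _)
      exact le_coe_truncUnit ((sub_le_self _ (by positivity)).trans
        ((min_le_left _ _).trans r.2.2))
    · have h1 : (1 : ℝ) ≤ K * orbitDefect p (k + j) w :=
        hK.le.trans (mul_le_mul_of_nonneg_left hw.le (Nat.cast_nonneg _))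
      have h2 : 0 ≤ (N : ℝ) * dist (fun i => w (Fin.castAdd j i)) u := by positivity
      have h3 : min (r : ℝ) (m * Θ M w) ≤ 1 := (min_le_left _ _).trans r.2.2
      refine le_trans ?_ (add_nonneg (unitInterval.nonneg _) hη.le)
      rw [orbitPenalty]
      linarith
  · rw [orbitPenalty, orbitDefect_preimageTuple, mul_zero, sub_zero]
    rfl

/-- The grey relation `sup {r - N d(g⁻¹ p, u) : Θ(g⁻¹ p) > 0}`, written as a countable supremum of
suprema over an orbit: `min(r, m Θ)` increases with `m` to `r` where `Θ > 0`, and is `0`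
elsewhere. -/
noncomputable def orbitSup (p : ℕ → U) (k j N : ℕ) (r : unitInterval)
    (Θ : MetricModel L U → (Fin (k + j) → U) → unitInterval) (M : MetricModel L U)
    (u : Fin k → U) : unitInterval :=
  ⨆ m : ℕ, ⨆ g : U ≃ᵢ U, truncUnit (min (r : ℝ) (m * Θ M (preimageTuple p (k + j) g))
    - N * dist (preimageTuple p k g) u)

lemma isValueLipschitz_orbitSup (p : ℕ → U) (k j N : ℕ) (r : unitInterval)
    (Θ : MetricModel L U → (Fin (k + j) → U) → unitInterval) :
    IsValueLipschitz N (orbitSup p k j N r Θ) :=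
  IsValueLipschitz.iSup fun _ => IsValueLipschitz.iSup fun _ =>
    isValueLipschitz_truncUnit_sub N _ (fun _ => (min_le_left _ _).trans r.2.2) _

lemma IsUrysohnSphere.isDefinable_orbitSup (hU : IsUrysohnSphere U) (p : ℕ → U) {k j : ℕ} (N : ℕ)
    (r : unitInterval) {Θ : MetricModel L U → (Fin (k + j) → U) → unitInterval}
    (hΘ : IsDefinable Θ) (hΘc : IsEquicontinuous Θ) : IsDefinable (orbitSup p k j N r Θ) := by
  refine IsDefinable.iSup hU.dist_le_one (N := N) (fun m => ?_) (fun m =>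
    IsValueLipschitz.iSup fun g => isValueLipschitz_truncUnit_sub N _
      (fun _ => (min_le_left _ _).trans r.2.2) _)
  have := IsDefinable.iInf hU.dist_le_one
    (fun K => isDefinable_iSup_orbitPenalty hU.dist_le_one p N r hΘ m K)
    (fun K => isValueLipschitz_iSup_orbitPenalty p k j N r Θ m K)
  exact (congrArg IsDefinable (funext fun M => funext fun u =>
    hU.iSup_orbit_eq p N r hΘc m M u)).mp this

lemma lt_orbitSup_iff (p : ℕ → U) {k j N : ℕ} {r : unitInterval}
    {Θ : MetricModel L U → (Fin (k + j) → U) → unitInterval} {M : MetricModel L U}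
    {u : Fin k → U} {s : unitInterval} :
    s < orbitSup p k j N r Θ M u ↔ ∃ g : U ≃ᵢ U,
      0 < Θ M (preimageTuple p (k + j) g) ∧ (s : ℝ) < r - N * dist (preimageTuple p k g) u := by
  have hle : ∀ (m : ℕ) (g : U ≃ᵢ U), min (r : ℝ) (m * Θ M (preimageTuple p (k + j) g))
      - N * dist (preimageTuple p k g) u ≤ 1 := fun m g =>
    (sub_le_self _ (by positivity)).trans ((min_le_left _ _).trans r.2.2)
  simp only [orbitSup, lt_iSup_iff, lt_truncUnit_iff (hle _ _)]
  constructor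
  · rintro ⟨m, g, h⟩
    have hN : 0 ≤ (N : ℝ) * dist (preimageTuple p k g) u := by positivity
    have hs := s.2.1
    refine ⟨g, ?_, h.trans_le (sub_le_sub_right (min_le_left _ _) _)⟩
    by_contra h0
    have h1 : Θ M (preimageTuple p (k + j) g) = 0 := le_antisymm (not_lt.mp h0) bot_le
    have h2 := min_le_right (r : ℝ) (m * Θ M (preimageTuple p (k + j) g))
    rw [h1, Set.Icc.coe_zero, mul_zero] at h h2
    linarith
  · rintro ⟨g, h0, h⟩
    have h0' : (0 : ℝ) < Θ M (preimageTuple p (k + j) g) := Subtype.coe_lt_coe.mpr h0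
    obtain ⟨m, hm⟩ := exists_nat_gt (1 / (Θ M (preimageTuple p (k + j) g) : ℝ))
    rw [div_lt_iff₀ h0'] at hm
    exact ⟨m, g, by rwa [min_eq_left (r.2.2.trans hm.le)]⟩

end OrbitQuantifier

/-! ### Vaught transforms of Borel sets -/

section SupStar

variable {Y : Type w} [TopologicalSpace Y]

lemma supStar_le_supStar_add {B B' : Y → unitInterval} {c : ℝ} (hc : 0 ≤ c)
    (h : ∀ y, (B y : ℝ) ≤ B' y + c) : (supStar B : ℝ) ≤ supStar B' + c := by
  by_contra! hlt
  have h1 : truncUnit (supStar B' + c) < supStar B := Subtype.coe_lt_coe.mp <|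
    lt_of_le_of_lt (coe_truncUnit_le (add_nonneg (unitInterval.nonneg _) hc) le_rfl) hlt
  rw [lt_supStar_iff] at h1
  refine lt_irrefl (supStar B') ((lt_supStar_iff B' _).mpr fun hm => h1 (hm.mono fun y hy => ?_))
  have h2 := (le_coe_truncUnit (hlt.le.trans (unitInterval.le_one _))).trans_lt
    (Subtype.coe_lt_coe.mpr hy)
  have h3 : (supStar B' : ℝ) < B' y := by linarith [h y]
  exact Subtype.coe_lt_coe.mp h3

end SupStar

section Vaught

variable {L : MetricLanguage.{u, v}} {U : Type w} [MetricSpace U]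

/-- The grey Vaught transform of the grey set that takes the value `r` on the set `B` and `0`
elsewhere. -/
noncomputable def vaught (p : ℕ → U) (k N : ℕ) (r : unitInterval) (B : Set (MetricModel L U))
    (M : MetricModel L U) (u : Fin k → U) : unitInterval :=
  supStar fun g : U ≃ᵢ U =>
    truncUnit (B.indicator (fun _ => (r : ℝ)) (g • M) - N * dist (preimageTuple p k g) u)

lemma isValueLipschitz_vaught (p : ℕ → U) (k N : ℕ) (r : unitInterval)
    (B : Set (MetricModel L U)) : IsValueLipschitz N (vaught p k N r B) := fun M u u' =>
  supStar_le_supStar_add (by positivity) fun g => isValueLipschitz_truncUnit_sub N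
    (fun M => B.indicator (fun _ => (r : ℝ)) (g • M))
    (fun _ => Set.indicator_apply_le' (fun _ => r.2.2) (fun _ => zero_le_one))
    (fun _ => preimageTuple p k g) M u u'

lemma lt_vaught_iff {p : ℕ → U} {k N : ℕ} {r : unitInterval} {B : Set (MetricModel L U)}
    {M : MetricModel L U} {u : Fin k → U} {s : unitInterval} :
    s < vaught p k N r B M u ↔ ¬ IsMeagre ({g : U ≃ᵢ U | g • M ∈ B} ∩
      {g : U ≃ᵢ U | (s : ℝ) < r - N * dist (preimageTuple p k g) u}) := by
  rw [vaught, lt_supStar_iff]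
  have : ∀ g : U ≃ᵢ U, 0 ≤ (N : ℝ) * dist (preimageTuple p k g) u := fun g => by positivity
  suffices h : {g : U ≃ᵢ U | s < truncUnit (B.indicator (fun _ => (r : ℝ)) (g • M) -
      N * dist (preimageTuple p k g) u)} = {g : U ≃ᵢ U | g • M ∈ B} ∩
      {g : U ≃ᵢ U | (s : ℝ) < r - N * dist (preimageTuple p k g) u} by rw [h]
  ext g
  have hg := this g
  have hs := s.2.1
  by_cases hB : g • M ∈ B
  · simp only [Set.mem_ofPred_eq, Set.mem_inter_iff, Set.indicator_of_mem hB, hB, true_and]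
    exact lt_truncUnit_iff (by linarith [r.2.2])
  · simp only [Set.mem_ofPred_eq, Set.mem_inter_iff, Set.indicator_of_notMem hB, hB, false_and,
      iff_false]
    rw [lt_truncUnit_iff (by linarith)]
    linarith

lemma isOpen_lt_sub_dist (p : ℕ → U) (k N : ℕ) (r s : unitInterval) (u : Fin k → U) :
    IsOpen {g : U ≃ᵢ U | (s : ℝ) < r - N * dist (preimageTuple p k g) u} :=
  isOpen_lt continuous_const (continuous_const.sub
    (continuous_const.mul ((continuous_preimageTuple p k).dist continuous_const)))

lemma IsValueLipschitz.isEquicontinuous {k N : ℕ}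
    {F : MetricModel L U → (Fin k → U) → unitInterval} (hF : IsValueLipschitz N F) :
    IsEquicontinuous F := by
  intro η hη
  refine ⟨η / (N + 1), by positivity, fun M w w' h => (hF M w w').trans ?_⟩
  have h1 : (N : ℝ) * dist w w' ≤ (N + 1) * (η / (N + 1)) := by gcongr; linarith
  rw [mul_div_cancel₀ _ (by positivity)] at h1
  linarith

lemma IsDefinable.comp_one {k : ℕ} {F : MetricModel L U → (Fin k → U) → unitInterval}
    (hF : IsDefinable F) {h : unitInterval → unitInterval} (hh : Continuous h) :
    IsDefinable (fun M u => h (F M u)) :=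
  IsDefinable.comp (ι := Unit) (h := fun x => h (x ())) (by fun_prop) fun _ => hF

/-- The complement of the Vaught transform of `B` is positive at a tuple `g₀⁻¹ p` if and only if
`g • M ∉ B` for generic `g` close to `g₀` in the sense of that tuple. -/
lemma symm_vaught_pos_iff {p : ℕ → U} {l : ℕ} {B : Set (MetricModel L U)} {M : MetricModel L U}
    {w : Fin l → U} : 0 < unitInterval.symm (vaught p l 1 1 B M w) ↔
      ∃ δ : ℝ, 0 < δ ∧ IsMeagre ({g : U ≃ᵢ U | g • M ∈ B} ∩
        {g : U ≃ᵢ U | dist (preimageTuple p l g) w < δ}) := by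
  have h1 : 0 < unitInterval.symm (vaught p l 1 1 B M w) ↔
      (vaught p l 1 1 B M w : ℝ) < 1 := by
    rw [← Subtype.coe_lt_coe, unitInterval.coe_symm_eq, Set.Icc.coe_zero, sub_pos]
  rw [h1]
  constructor
  · intro h
    refine ⟨1 - vaught p l 1 1 B M w, sub_pos.mpr h, ?_⟩
    have h2 := not_not.mp (mt lt_vaught_iff.mpr (lt_irrefl (vaught p l 1 1 B M w)))
    refine h2.mono (Set.inter_subset_inter_right _ fun g hg => ?_)
    simp only [Set.mem_ofPred_eq, Nat.cast_one, one_mul, Set.Icc.coe_one] at hg ⊢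
    linarith
  · rintro ⟨δ, hδ, hm⟩
    have h2 : ¬ truncUnit (1 - δ) < vaught p l 1 1 B M w := fun h => by
      refine lt_vaught_iff.mp h (hm.mono (Set.inter_subset_inter_right _ fun g hg => ?_))
      simp only [Set.mem_ofPred_eq, Nat.cast_one, one_mul, Set.Icc.coe_one] at hg ⊢
      linarith [le_coe_truncUnit (show 1 - δ ≤ 1 by linarith)]
    refine (Subtype.coe_le_coe.mpr (not_lt.mp h2)).trans_lt ?_
    rw [coe_truncUnit]
    exact max_lt one_pos (min_lt_of_right_lt (by linarith))

/-- The complement of a set whose Vaught transforms are definable has definable transforms. By the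
Baire property of `{g | g • M ∉ B}`, this set is nonmeagre in an open set if and only if it is
comeagre in a basic open subset, and this can be expressed by the transforms of `B`. -/
lemma isDefinable_vaught_compl (hU : IsUrysohnSphere U) {p : ℕ → U} (hp : DenseRange p)
    {B : Set (MetricModel L U)} (hB : MeasurableSet B)
    (h : ∀ l, IsDefinable (vaught p l 1 1 B)) (k N : ℕ) (r : unitInterval) :
    IsDefinable (vaught p k N r Bᶜ) := by
  have := hU.complete
  have := baireSpace_isometryEquiv hp
  let Θ : (l : ℕ) → MetricModel L U → (Fin l → U) → unitInterval := fun l M w =>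
    unitInterval.symm (vaught p l 1 1 B M w)
  have hΘd : ∀ l, IsDefinable (Θ l) := fun l => (h l).comp_one unitInterval.continuous_symm
  have hΘc : ∀ l, IsEquicontinuous (Θ l) := fun l =>
    IsValueLipschitz.isEquicontinuous (N := 1) fun M w w' => by
      have := isValueLipschitz_vaught p l 1 1 B M w' w
      simp only [Θ, unitInterval.coe_symm_eq]
      rw [dist_comm] at this
      linarith
  have heq : vaught p k N r Bᶜ = fun M u => ⨆ j, orbitSup p k j N r (Θ (k + j)) M u := by
    funext M u
    refine eq_of_forall_lt_iff fun s => ?_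
    simp only [lt_vaught_iff, lt_iSup_iff, lt_orbitSup_iff, Θ, symm_vaught_pos_iff]
    rw [not_isMeagre_inter_iff (M.baireMeasurableSet_smul_mem hB.compl)
      (isOpen_lt_sub_dist p k N r s u)]
    constructor
    · rintro ⟨W, hWV, hW, ⟨g₀, hg₀⟩, hm⟩
      obtain ⟨j, δ, hδ, hj⟩ := exists_preimageTuple_subset hp k hW hg₀
      refine ⟨j, g₀, ⟨δ, hδ, hm.mono fun g hg => ?_⟩, hWV hg₀⟩
      exact ⟨hj hg.2, not_not.mpr hg.1⟩
    · rintro ⟨j, g₀, ⟨δ, hδ, hm⟩, hg₀⟩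
      refine ⟨{g | dist (preimageTuple p (k + j) g) (preimageTuple p (k + j) g₀) < δ} ∩ _,
        Set.inter_subset_right, IsOpen.inter ?_ (isOpen_lt_sub_dist p k N r s u),
        ⟨g₀, ?_, hg₀⟩, hm.mono fun g hg => ?_⟩
      · exact isOpen_lt ((continuous_preimageTuple p (k + j)).dist continuous_const)
          continuous_const
      · simpa using hδ
      · exact ⟨not_not.mp hg.2, hg.1.1⟩
  rw [heq]
  exact IsDefinable.iSup hU.dist_le_one
    (fun j => hU.isDefinable_orbitSup p N r (hΘd (k + j)) (hΘc (k + j)))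
    (fun j => isValueLipschitz_orbitSup p k j N r (Θ (k + j)))

lemma isDefinable_vaught_iUnion (hd : ∀ x y : U, dist x y ≤ 1) {p : ℕ → U} {k N : ℕ}
    {r : unitInterval} {B : ℕ → Set (MetricModel L U)}
    (h : ∀ n, IsDefinable (vaught p k N r (B n))) :
    IsDefinable (vaught p k N r (⋃ n, B n)) := by
  have heq : vaught p k N r (⋃ n, B n) = fun M u => ⨆ n, vaught p k N r (B n) M u := by
    funext M u
    refine eq_of_forall_lt_iff fun s => ?_
    simp only [lt_iSup_iff, lt_vaught_iff]
    constructor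
    · intro hm
      by_contra! hcon
      refine hm ((isMeagre_iUnion hcon).mono fun g hg => ?_)
      obtain ⟨n, hn⟩ := Set.mem_iUnion.mp hg.1
      exact Set.mem_iUnion.mpr ⟨n, hn, hg.2⟩
    · rintro ⟨n, hn⟩ hm
      refine hn (hm.mono fun g hg => ?_)
      exact ⟨Set.mem_iUnion.mpr ⟨n, hg.1⟩, hg.2⟩
  rw [heq]
  exact IsDefinable.iSup hd h fun n => isValueLipschitz_vaught p k N r (B n)

lemma isDefinable_vaught_empty {p : ℕ → U} {k N : ℕ} {r : unitInterval} :
    IsDefinable (vaught p k N r (∅ : Set (MetricModel L U))) := by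
  have heq : vaught p k N r (∅ : Set (MetricModel L U)) = fun _ _ => 0 := by
    funext M u
    refine eq_of_forall_lt_iff fun s => ?_
    simp [lt_vaught_iff, IsMeagre.empty]
  rw [heq]
  exact IsDefinable.comp (ι := Empty) (h := fun _ => 0) continuous_const
    (F := fun i => i.elim) fun i => i.elim

/-! ### Basic Borel sets -/

lemma IsEquicontinuous.continuous {l : ℕ} {Θ : MetricModel L U → (Fin l → U) → unitInterval}
    (h : IsEquicontinuous Θ) (M : MetricModel L U) : Continuous (Θ M) := by
  refine Metric.continuous_iff.mpr fun w η hη => ?_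
  obtain ⟨δ, hδ, hδΘ⟩ := h (η / 2) (by positivity)
  refine ⟨δ, hδ, fun w' hw => ?_⟩
  have h1 := hδΘ M w' w hw.le
  have h2 := hδΘ M w w' (by rw [dist_comm]; exact hw.le)
  rw [Subtype.dist_eq, Real.dist_eq, abs_lt]
  constructor <;> linarith

/-- Let `Θ` be a definable isomorphism invariant grey relation. The set of the structures in which
`Θ` exceeds `q` at an initial segment of `p` has definable Vaught transforms: it pulls back to an
open subset of the isometry group, so that nonmeagre may be replaced by nonempty. -/
lemma isDefinable_vaught_lt (hU : IsUrysohnSphere U) {p : ℕ → U} (hp : DenseRange p) {n : ℕ}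
    {Θ : MetricModel L U → (Fin n → U) → unitInterval} (hΘ : IsDefinable Θ)
    (hΘc : IsEquicontinuous Θ)
    (hinv : ∀ (g : U ≃ᵢ U) M w, Θ (g • M) w = Θ M (fun i => g⁻¹ (w i)))
    (q r : unitInterval) (k N : ℕ) :
    IsDefinable (vaught p k N r {M : MetricModel L U | q < Θ M (fun i => p i)}) := by
  have := hU.complete
  have := baireSpace_isometryEquiv hp
  -- Tuples of length `k + n` contain both `g⁻¹ p|k`, compared with `u`, and `g⁻¹ p|n`, at which
  -- `Θ` is evaluated.
  let e : Fin n → Fin (k + n) := Fin.castLE (Nat.le_add_left n k)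
  let Θ' : MetricModel L U → (Fin (k + n) → U) → unitInterval := fun M w =>
    truncUnit ((Θ M fun i => w (e i) : ℝ) - q)
  have hΘ'd : IsDefinable Θ' := (hΘ.rename e).comp_one (h := fun x => truncUnit ((x : ℝ) - q))
    (continuous_truncUnit.comp (by fun_prop))
  have hΘ'c : IsEquicontinuous Θ' := by
    intro η hη
    obtain ⟨δ, hδ, h⟩ := hΘc η hη
    refine ⟨δ, hδ, fun M w w' hw => coe_truncUnit_le
      (add_nonneg (unitInterval.nonneg _) hη.le) ?_⟩
    have h1 := h M (fun i => w (e i)) (fun i => w' (e i)) <|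
      (dist_pi_le_iff hδ.le).mpr fun i => (dist_le_pi_dist w w' (e i)).trans hw
    have h2 : (Θ M fun i => w' (e i) : ℝ) - q ≤ Θ' M w' :=
      le_coe_truncUnit ((sub_le_self _ q.2.1).trans (unitInterval.le_one _))
    linarith
  have heq : vaught p k N r {M : MetricModel L U | q < Θ M (fun i => p i)} =
      orbitSup p k n N r Θ' := by
    funext M u
    refine eq_of_forall_lt_iff fun s => ?_
    have hset : {g : U ≃ᵢ U | g • M ∈ {M : MetricModel L U | q < Θ M (fun i => p i)}} =
        {g | q < Θ M (preimageTuple p n g)} := Set.ext fun g => by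
      simp only [Set.mem_ofPred_eq, hinv]
    have hpos : ∀ g, 0 < Θ' M (preimageTuple p (k + n) g) ↔ q < Θ M (preimageTuple p n g) := by
      intro g
      rw [lt_truncUnit_iff ((sub_le_self _ q.2.1).trans (unitInterval.le_one _)),
        Set.Icc.coe_zero, sub_pos, Subtype.coe_lt_coe]
      rfl
    have hopen : IsOpen {g | q < Θ M (preimageTuple p n g)} :=
      isOpen_lt continuous_const ((hΘc.continuous M).comp (continuous_preimageTuple p n))
    simp only [lt_vaught_iff, lt_orbitSup_iff, hset, hpos]
    constructor
    · exact fun h => nonempty_of_not_isMeagre h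
    · exact fun h => not_isMeagre_of_isOpen (hopen.inter (isOpen_lt_sub_dist p k N r s u)) h
  rw [heq]
  exact hU.isDefinable_orbitSup p N r hΘ'd hΘ'c

end Vaught

/-! ### The Borel structure of the space of structures -/

section Borel

open Filter Topology

variable {L : MetricLanguage.{u, v}} {U : Type w} [MetricSpace U]

/-- Indices of the atomic relations `d(f(p_a), p_j)` and `R(p_a)` at points of a sequence `p`, for
tuples `a` of natural numbers. -/
abbrev AtomicIndex (L : MetricLanguage.{u, v}) : Type (max u v) :=
  (Σ f : L.Func, (Fin (L.funcArity f) → ℕ) × ℕ) ⊕ (Σ R : L.Rel, Fin (L.relArity R) → ℕ)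

/-- The values of all atomic relations at points of the sequence `p`. -/
noncomputable def atomicValues (p : ℕ → U) (M : MetricModel L U) : AtomicIndex L → unitInterval
  | .inl ⟨f, a, j⟩ => truncUnit (dist (M.func f (fun i => p (a i))) (p j))
  | .inr ⟨R, a⟩ => M.rel R (fun i => p (a i))

/-- Pointwise convergence on a dense set of a family of maps with a common modulus of continuity
implies pointwise convergence. -/
lemma ContModulus.tendsto_of_denseRange (w : ContModulus) {p : ℕ → U} (hp : DenseRange p) {n : ℕ}
    {Z : Type*} [PseudoMetricSpace Z] {α : Type*} {l : Filter α} {F : α → (Fin n → U) → Z}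
    {F₀ : (Fin n → U) → Z} (hF : ∀ a x y, nndist (F a x) (F a y) ≤ w.toFun (nndist x y))
    (hF₀ : ∀ x y, nndist (F₀ x) (F₀ y) ≤ w.toFun (nndist x y))
    (h : ∀ c : Fin n → ℕ, Tendsto (fun a => F a (fun i => p (c i))) l
      (𝓝 (F₀ (fun i => p (c i))))) (x : Fin n → U) :
    Tendsto (fun a => F a x) l (𝓝 (F₀ x)) := by
  refine Metric.tendsto_nhds.mpr fun ε hε => ?_
  have h1 : ∀ᶠ y in 𝓝 x, (w.toFun (nndist y x) : ℝ) < ε / 3 :=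
    (w.tendsto_nndist tendsto_id).eventually (gt_mem_nhds (by positivity))
  have hdense : DenseRange (fun c : Fin n → ℕ => fun i => p (c i)) :=
    DenseRange.piMap (fun _ => hp)
  obtain ⟨_, ⟨c, rfl⟩, hc⟩ :=
    ((mem_closure_iff_frequently.mp (hdense x)).and_eventually h1).exists
  filter_upwards [Metric.tendsto_nhds.mp (h c) (ε / 3) (by positivity)] with a ha
  have h2 : dist (F a (fun i => p (c i))) (F a x) ≤ w.toFun (nndist (fun i => p (c i)) x) := by
    exact_mod_cast hF a _ _
  have h3 : dist (F₀ (fun i => p (c i))) (F₀ x) ≤ w.toFun (nndist (fun i => p (c i)) x) := by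
    exact_mod_cast hF₀ _ _
  have h4 := dist_triangle4 (F a x) (F a (fun i => p (c i))) (F₀ (fun i => p (c i))) (F₀ x)
  rw [dist_comm (F a x) (F a _)] at h4
  linarith

/-- The topology of the space of structures is that of pointwise convergence of the atomic relations
at points of `p`. In particular it is second countable for a countable language. -/
lemma isInducing_atomicValues (hd : ∀ x y : U, dist x y ≤ 1) {p : ℕ → U} (hp : DenseRange p) :
    IsInducing (atomicValues (L := L) p) := by
  have hcont : Continuous (fun M : MetricModel L U => (M.func, M.rel)) := continuous_induced_dom
  refine isInducing_iff_nhds.mpr fun M => le_antisymm ?_ ?_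
  · refine Continuous.tendsto (continuous_pi fun c => ?_) M |>.le_comap
    rcases c with ⟨f, a, j⟩ | ⟨R, a⟩
    · exact continuous_truncUnit.comp ((((continuous_apply _).comp
        ((continuous_apply f).comp (continuous_fst.comp hcont)))).dist continuous_const)
    · exact (continuous_apply _).comp ((continuous_apply R).comp (continuous_snd.comp hcont))
  · have hlim : ∀ c, Tendsto (fun M' => atomicValues p M' c)
        (comap (atomicValues p) (𝓝 (atomicValues p M))) (𝓝 (atomicValues p M c)) := fun c =>
      ((continuous_apply c).tendsto (atomicValues p M)).comp tendsto_comap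
    generalize comap (atomicValues p) (𝓝 (atomicValues p M)) = l at hlim
    have hfunc : ∀ f, Tendsto (fun M' : MetricModel L U => M'.func f) l (𝓝 (M.func f)) := by
      refine fun f => tendsto_pi_nhds.mpr ((L.funcModulus f).tendsto_of_denseRange hp
        (fun M' => M'.func_modulus f) (M.func_modulus f) fun c => ?_)
      refine Metric.tendsto_nhds.mpr fun ε hε => ?_
      obtain ⟨j, hj⟩ := hp.exists_dist_lt (M.func f fun i => p (c i)) (half_pos hε)
      have h1 := (continuous_subtype_val.tendsto _).comp (hlim (.inl ⟨f, c, j⟩))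
      simp only [atomicValues, coe_truncUnit_of_mem dist_nonneg (hd _ _), Function.comp_def] at h1
      filter_upwards [h1.eventually (gt_mem_nhds hj)] with M' hM'
      have h2 := dist_triangle_right (M'.func f fun i => p (c i)) (M.func f fun i => p (c i)) (p j)
      linarith
    have hrel : ∀ R, Tendsto (fun M' : MetricModel L U => M'.rel R) l (𝓝 (M.rel R)) := fun R =>
      tendsto_pi_nhds.mpr ((L.relModulus R).tendsto_of_denseRange hp
        (fun M' => M'.rel_modulus R) (M.rel_modulus R) fun c => hlim (.inr ⟨R, c⟩))
    rw [nhds_induced, ← tendsto_id', tendsto_comap_iff]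
    exact (tendsto_pi_nhds.mpr hfunc).prodMk_nhds (tendsto_pi_nhds.mpr hrel)

lemma MetricLanguage.IsCountable.countable_atomicIndex (hL : L.IsCountable) :
    Countable (AtomicIndex L) := by
  have := hL.1
  have := hL.2
  infer_instance

/-- An atomic relation at points of `p` is the value of an invariant definable relation. -/
lemma isDefinable_vaught_atomicValues (hU : IsUrysohnSphere U) {p : ℕ → U} (hp : DenseRange p)
    (c : AtomicIndex L) (q r : unitInterval) (k N : ℕ) :
    IsDefinable (vaught p k N r {M : MetricModel L U | q < atomicValues p M c}) := by
  rcases c with ⟨f, a, j⟩ | ⟨R, a⟩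
  · obtain ⟨n, hn⟩ := (Set.finite_range a).bddAbove
    have ha : ∀ i, a i < max n j + 1 := fun i =>
      Nat.lt_succ_of_le ((hn (Set.mem_range_self i)).trans (le_max_left _ _))
    have hj : j < max n j + 1 := Nat.lt_succ_of_le (le_max_right _ _)
    refine isDefinable_vaught_lt hU hp (n := max n j + 1)
      (Θ := fun M w => truncUnit (dist (M.func f fun i => w ⟨a i, ha i⟩) (w ⟨j, hj⟩)))
      ⟨.dist (.app f fun i => .var ⟨a i, ha i⟩) (.var ⟨j, hj⟩), trivial, fun _ _ => rfl⟩
      (fun η hη => ?_) (fun g M w => ?_) q r k N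
    · have h1 := (L.funcModulus f).continuous_toFun.tendsto 0
      rw [(L.funcModulus f).map_zero] at h1
      obtain ⟨δ, hδ, h⟩ := Metric.tendsto_nhds_nhds.mp h1 (η / 2) (by positivity)
      refine ⟨min (δ / 2) (η / 2), by positivity, fun M w w' hw => coe_truncUnit_le
        (add_nonneg (unitInterval.nonneg _) hη.le) ?_⟩
      rw [coe_truncUnit_of_mem dist_nonneg (hU.dist_le_one _ _)]
      have h2 : dist (fun i => w ⟨a i, ha i⟩) (fun i => w' ⟨a i, ha i⟩) ≤ dist w w' :=
        (dist_pi_le_iff dist_nonneg).mpr fun i => dist_le_pi_dist w w' _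
      have h3 : dist (M.func f fun i => w ⟨a i, ha i⟩) (M.func f fun i => w' ⟨a i, ha i⟩) <
          η / 2 := by
        have h4 := h (x := nndist (fun i => w ⟨a i, ha i⟩) (fun i => w' ⟨a i, ha i⟩)) (by
          rw [NNReal.dist_eq, NNReal.coe_zero, sub_zero, coe_nndist, abs_of_nonneg dist_nonneg]
          linarith [min_le_left (δ / 2) (η / 2)])
        rw [NNReal.dist_eq, NNReal.coe_zero, sub_zero, abs_of_nonneg (NNReal.coe_nonneg _)] at h4
        refine lt_of_le_of_lt ?_ h4
        exact_mod_cast M.func_modulus f _ _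
      have h5 := dist_le_pi_dist w w' ⟨j, hj⟩
      have h6 := dist_triangle4 (M.func f fun i => w ⟨a i, ha i⟩)
        (M.func f fun i => w' ⟨a i, ha i⟩) (w' ⟨j, hj⟩) (w ⟨j, hj⟩)
      rw [dist_comm (w' ⟨j, hj⟩)] at h6
      linarith [min_le_right (δ / 2) (η / 2)]
    · have h1 : (g • M).func f (fun i => w ⟨a i, ha i⟩) =
          g (M.func f fun i => g⁻¹ (w ⟨a i, ha i⟩)) := rfl
      rw [h1, ← g⁻¹.dist_eq, IsometryEquiv.inv_apply_self]
  · obtain ⟨n, hn⟩ := (Set.finite_range a).bddAbove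
    have ha : ∀ i, a i < n + 1 := fun i => Nat.lt_succ_of_le (hn (Set.mem_range_self i))
    refine isDefinable_vaught_lt hU hp (n := n + 1)
      (Θ := fun M w => M.rel R fun i => w ⟨a i, ha i⟩)
      ⟨.rel R fun i => .var ⟨a i, ha i⟩, trivial, fun _ _ => rfl⟩
      (fun η hη => ?_) (fun g M w => rfl) q r k N
    have h1 := (L.relModulus R).continuous_toFun.tendsto 0
    rw [(L.relModulus R).map_zero] at h1
    obtain ⟨δ, hδ, h⟩ := Metric.tendsto_nhds_nhds.mp h1 η hη
    refine ⟨δ / 2, by positivity, fun M w w' hw => ?_⟩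
    have h2 : dist (fun i => w ⟨a i, ha i⟩) (fun i => w' ⟨a i, ha i⟩) ≤ dist w w' :=
      (dist_pi_le_iff dist_nonneg).mpr fun i => dist_le_pi_dist w w' _
    have h4 := h (x := nndist (fun i => w ⟨a i, ha i⟩) (fun i => w' ⟨a i, ha i⟩)) (by
      rw [NNReal.dist_eq, NNReal.coe_zero, sub_zero, coe_nndist, abs_of_nonneg dist_nonneg]
      linarith)
    rw [NNReal.dist_eq, NNReal.coe_zero, sub_zero, abs_of_nonneg (NNReal.coe_nonneg _)] at h4
    have h5 : dist (M.rel R fun i => w ⟨a i, ha i⟩) (M.rel R fun i => w' ⟨a i, ha i⟩) < η := by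
      refine lt_of_le_of_lt ?_ h4
      exact_mod_cast M.rel_modulus R _ _
    rw [Subtype.dist_eq, Real.dist_eq, abs_lt] at h5
    linarith [h5.2]

/-- The σ-algebra of the Borel sets whose Vaught transforms with `N = r = 1` are definable, for all
lengths of tuples. Other values of `N` and `r` are not needed here, since
`isDefinable_vaught_compl` produces them. -/
abbrev definableVaughtSpace (hU : IsUrysohnSphere U) {p : ℕ → U} (hp : DenseRange p) :
    MeasurableSpace (MetricModel L U) where
  MeasurableSet' B := MeasurableSet B ∧ ∀ k, IsDefinable (vaught p k 1 1 B)
  measurableSet_empty := ⟨MeasurableSet.empty, fun _ => isDefinable_vaught_empty⟩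
  measurableSet_compl _ hB :=
    ⟨hB.1.compl, fun k => isDefinable_vaught_compl hU hp hB.1 hB.2 k 1 1⟩
  measurableSet_iUnion _ hB := ⟨MeasurableSet.iUnion fun n => (hB n).1,
    fun k => isDefinable_vaught_iUnion hU.dist_le_one fun n => (hB n).2 k⟩

lemma borel_le_definableVaughtSpace (hL : L.IsCountable) (hU : IsUrysohnSphere U) {p : ℕ → U}
    (hp : DenseRange p) : borel (MetricModel L U) ≤ definableVaughtSpace hU hp := by
  have := hL.countable_atomicIndex
  have hind := isInducing_atomicValues (L := L) hU.dist_le_one hp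
  have hmeas : @Measurable _ _ (definableVaughtSpace hU hp) _ (atomicValues (L := L) p) := by
    refine @measurable_pi_lambda _ _ _ (definableVaughtSpace hU hp) _ _ fun c => ?_
    refine measurable_of_Ioi (mδ := definableVaughtSpace hU hp) fun q => ?_
    refine ⟨?_, fun k => isDefinable_vaught_atomicValues hU hp c q 1 k 1⟩
    exact (isOpen_lt continuous_const
      ((continuous_apply c).comp hind.continuous)).measurableSet
  rw [hind.eq_induced, borel_comap,
    ← BorelSpace.measurable_eq (α := AtomicIndex L → unitInterval)]
  exact measurable_iff_comap_le.mp hmeas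

/-- Every Borel set is a complement, so one more application of `isDefinable_vaught_compl` gives all
`N` and `r`. -/
lemma isDefinable_vaught (hL : L.IsCountable) (hU : IsUrysohnSphere U) {p : ℕ → U}
    (hp : DenseRange p) {B : Set (MetricModel L U)} (hB : MeasurableSet B) (k N : ℕ)
    (r : unitInterval) : IsDefinable (vaught p k N r B) := by
  have h := isDefinable_vaught_compl hU hp hB.compl
    (borel_le_definableVaughtSpace hL hU hp _ hB.compl).2 k N r
  rwa [compl_compl] at h

/-- A grey set `A` is the supremum, over a countable dense set of values `q`, of the grey sets equal
to `q` on `{A > q}` and to `0` elsewhere, and `sup*` commutes with countable suprema. -/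
lemma supStar_eq_iSup_vaught (p : ℕ → U) (k N : ℕ) (A : MetricModel L U → unitInterval)
    (M : MetricModel L U) (u : Fin k → U) :
    supStar (fun g : U ≃ᵢ U => truncUnit ((A (g • M) : ℝ) - N * dist (preimageTuple p k g) u)) =
      ⨆ n, vaught p k N (TopologicalSpace.denseSeq unitInterval n)
        {M | TopologicalSpace.denseSeq unitInterval n < A M} M u := by
  have hle : ∀ g : U ≃ᵢ U, (A (g • M) : ℝ) - N * dist (preimageTuple p k g) u ≤ 1 := fun g =>
    (sub_le_self _ (by positivity)).trans (unitInterval.le_one _)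
  refine eq_of_forall_lt_iff fun s => ?_
  simp only [lt_supStar_iff, lt_truncUnit_iff (hle _), lt_iSup_iff, lt_vaught_iff]
  constructor
  · intro hm
    by_contra! hcon
    refine hm ((isMeagre_iUnion hcon).mono fun g hg => ?_)
    have hg' : (s : ℝ) + N * dist (preimageTuple p k g) u < A (g • M) := lt_sub_iff_add_lt.mp hg
    have hnn : 0 ≤ (s : ℝ) + N * dist (preimageTuple p k g) u :=
      add_nonneg s.2.1 (by positivity)
    obtain ⟨_, ⟨n, rfl⟩, h1, h2⟩ :=
      (TopologicalSpace.denseRange_denseSeq unitInterval).exists_between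
        (show (⟨_, hnn, hg'.le.trans (unitInterval.le_one _)⟩ : unitInterval) < A (g • M) from
          Subtype.coe_lt_coe.mp hg')
    exact Set.mem_iUnion.mpr ⟨n, h2, lt_sub_iff_add_lt.mpr (Subtype.coe_lt_coe.mpr h1)⟩
  · rintro ⟨n, hn⟩ hm
    refine hn (hm.mono fun g hg => ?_)
    have h1 : (TopologicalSpace.denseSeq unitInterval n : ℝ) < A (g • M) :=
      Subtype.coe_lt_coe.mpr hg.1
    have h2 := hg.2
    simp only [Set.mem_ofPred_eq] at h2 ⊢
    linarith

end Borel

theorem mainTheorem2 (L : MetricLanguage.{u, v}) (hL : L.IsCountable)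
    {U : Type w} [MetricSpace U] (hU : IsUrysohnSphere U)
    (p : ℕ → U) (hp : DenseRange p) (k : ℕ)
    (A : MetricModel L U → unitInterval) (hA : Measurable A)
    (N : ℕ) :
    ∃ φ : InfFormula L k, φ.IsLipschitz N ∧
      ∀ (M : MetricModel L U) (u : Fin k → U),
        supStar (fun g : U ≃ᵢ U =>
            truncUnit ((A (g • M) : ℝ) - N * dist (fun i : Fin k => g⁻¹ (p i)) u)) =
          φ.eval M u := by
  have hdef := fun n => isDefinable_vaught hL hU hp
    (measurableSet_lt (measurable_const (a := TopologicalSpace.denseSeq unitInterval n)) hA) k N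
    (TopologicalSpace.denseSeq unitInterval n)
  have hlip := fun n => isValueLipschitz_vaught p k N (TopologicalSpace.denseSeq unitInterval n)
    {M | TopologicalSpace.denseSeq unitInterval n < A M}
  obtain ⟨φ, hφ, hφN, hφA⟩ := (IsDefinable.iSup hU.dist_le_one hdef hlip).exists_isLipschitz
    hU.dist_le_one (IsValueLipschitz.iSup hlip)
  exact ⟨⟨φ, hφ⟩, hφN, fun M u =>
    (supStar_eq_iSup_vaught p k N A M u).trans (hφA M u).symm⟩
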